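/- Let $G$ be a simple graph with vertex set $V$ (for instance $\mathbb Z^d$ with nearest-neighbour edges). A walk $\omega=(\omega_0,\dots,\omega_n)$ in $G$ is a finite sequence of successively adjacent vertices; $|\omega|=n$ is its number of steps and $\mathrm{range}(\omega)$ the set of vertices it visits. It is closed if $\omega_n=\omega_0$, and self-avoiding if its vertices are distinct; a self-avoiding polygon is a closed walk with $|\omega|\ge 1$ in which $\omega_i=\omega_j$ with $i<j$ forces $i=0$, $j=|\omega|$ (so $(x,y,x)$ is one). For a walk $\omega$ that is not self-avoiding let $\tau=\min\{i : \omega_i=\omega_j \text{ for some } j<i\}$ and $\tau^\star=\min\{j:\omega_j=\omega_\tau\}$; a single loop erasure replaces $\omega$ by $(\omega_0,\dots,\omega_{\tau^\star},\omega_{\tau+1},\dots,\omega_n)$ and removes the self-avoiding polygon $(\omega_{\tau^\star},\dots,\omega_\tau)$. The loop erasure $\mathrm{LE}(\omega)$ is the self-avoiding walk obtained by iterating this, and $n_L^{\gamma}(\omega)$ is the number of times the polygon $\gamma$ is removed on the way. Let $z\in[0,\infty)$, and let $\lambda=(\lambda_\gamma)$ be a family of activities $\lambda_\gamma\in[0,\infty)$,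 indexed by the self-avoiding polygons $\gamma$ of $G$, with $\lambda_\gamma=\lambda_{\gamma'}$ whenever $\gamma'$ is a cyclic shift of $\gamma$ (the same oriented polygon with another initial vertex). Put $$w_{\lambda,z}(\omega)=z^{|\omega|}\prod_{\gamma}\lambda_\gamma^{\,n_L^{\gamma}(\omega)},\qquad \mu_{\lambda,z}(A)=\sum_{x\in V}\ \sum_{\substack{\omega\text{ a walk from }x\text{ to }x\\ |\omega|\ge 1,\ \mathrm{range}(\omega)\cap A\ne\emptyset}}\frac{w_{\lambda,z}(\omega)}{|\omega|}\quad(A\subseteq V),$$ and let the loop-erased weight $\bar w_{\lambda,z}(\eta)$ of a walk $\eta$ be $\sum_{\omega:\,\mathrm{LE}(\omega)=\eta}w_{\lambda,z}(\omega)$ if $\eta$ is self-avoiding and $0$ otherwise. **Theorem.** For every self-avoiding walk $\eta$ in $G$, $$\bar w_{\lambda,z}(\eta)=\sum_{\omega:\ \mathrm{LE}(\omega)=\eta} w_{\lambda,z}(\omega)=z^{|\eta|}\exp\bigl(\mu_{\lambda,z}(\mathrm{range}(\eta))\bigr),$$ as an identity in $[0,\infty]$ with $\exp(\infty)=\infty$.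 Moreover, if the susceptibility $\sum_{\omega:\ \omega_0=\eta_0}w_{\lambda,z}(\omega)$ is finite, then $\bar w_{\lambda,z}(\eta)$ and $\mu_{\lambda,z}(\mathrm{range}(\eta))$ are finite. -/

import Mathlib

open scoped NNReal ENNReal

namespace LWW

/-- A self-avoiding polygon of `G`: a closed walk with at least one step in which the only
coincidence of vertices is that of the initial and the final one. It carries its initial vertex
and its orientation; the two-step walks `(x, y, x)` are self-avoiding polygons. -/
structure SAPolygon {V : Type*} (G : SimpleGraph V) where
  base : V
  walk : G.Walk base base
  length_pos : 0 < walk.length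
  selfAvoiding : ∀ i j : ℕ, i < j → j ≤ walk.length → walk.getVert i = walk.getVert j →
    i = 0 ∧ j = walk.length

section LoopErasure

variable {V : Type*} {G : SimpleGraph V} {u v : V}

theorem exists_repeat {p : G.Walk u v} (h : ¬ p.IsPath) :
    ∃ i, i ≤ p.length ∧ ∃ j < i, p.getVert i = p.getVert j := by
  by_contra hc
  push Not at hc
  refine h ((SimpleGraph.Walk.IsPath.getVert_injOn_iff p).1 ?_)
  intro i hi j hj hij
  rcases lt_trichotomy i j with hlt | heq | hlt
  · exact absurd hij.symm (hc j hj i hlt)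
  · exact heq
  · exact absurd hij (hc i hi j hlt)

variable [DecidableEq V]

/-- `τ`: the first time at which the walk `p` is at a vertex it has visited before. -/
def tau (p : G.Walk u v) (h : ¬ p.IsPath) : ℕ :=
  Nat.find (exists_repeat h)

/-- `τ⋆`: the first time at which the walk `p` visits its vertex at time `τ`. -/
def tauStar (p : G.Walk u v) (h : ¬ p.IsPath) : ℕ :=
  Nat.find (p := fun j => p.getVert j = p.getVert (tau p h)) ⟨tau p h, rfl⟩

theorem tau_le_length (p : G.Walk u v) (h : ¬ p.IsPath) : tau p h ≤ p.length :=
  (Nat.find_spec (exists_repeat h)).1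

theorem getVert_tauStar (p : G.Walk u v) (h : ¬ p.IsPath) :
    p.getVert (tauStar p h) = p.getVert (tau p h) :=
  Nat.find_spec (p := fun j => p.getVert j = p.getVert (tau p h)) ⟨tau p h, rfl⟩

theorem tauStar_lt_tau (p : G.Walk u v) (h : ¬ p.IsPath) : tauStar p h < tau p h := by
  obtain ⟨j, hj, hij⟩ := (Nat.find_spec (exists_repeat h)).2
  exact lt_of_le_of_lt (Nat.find_min' _ hij.symm) hj

/-- The single loop erasure `(ω_0, …, ω_{τ⋆}, ω_{τ+1}, …, ω_n)` of a walk that is not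
self-avoiding. -/
def eraseOnce (p : G.Walk u v) (h : ¬ p.IsPath) : G.Walk u v :=
  (p.take (tauStar p h)).append ((p.drop (tau p h)).copy (getVert_tauStar p h).symm rfl)

theorem length_eraseOnce_lt (p : G.Walk u v) (h : ¬ p.IsPath) :
    (eraseOnce p h).length < p.length := by
  have h1 := tauStar_lt_tau p h
  have h2 := tau_le_length p h
  simp only [eraseOnce, SimpleGraph.Walk.length_append, SimpleGraph.Walk.length_copy,
    SimpleGraph.Walk.take_length, SimpleGraph.Walk.drop_length]
  omega

/-- The loop `(ω_{τ⋆}, …, ω_τ)` removed by the single loop erasure. -/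
def removedLoop (p : G.Walk u v) (h : ¬ p.IsPath) : SAPolygon G where
  base := p.getVert (tauStar p h)
  walk := ((p.drop (tauStar p h)).take (tau p h - tauStar p h)).copy rfl (by
    have h1 := tauStar_lt_tau p h
    rw [SimpleGraph.Walk.drop_getVert, Nat.add_sub_cancel' h1.le, getVert_tauStar])
  length_pos := by
    have h1 := tauStar_lt_tau p h
    have h2 := tau_le_length p h
    simp only [SimpleGraph.Walk.length_copy, SimpleGraph.Walk.take_length,
      SimpleGraph.Walk.drop_length]
    omega
  selfAvoiding := by
    intro i j hij hj heq
    have h1 := tauStar_lt_tau p h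
    have h2 := tau_le_length p h
    simp only [SimpleGraph.Walk.length_copy, SimpleGraph.Walk.take_length,
      SimpleGraph.Walk.drop_length, SimpleGraph.Walk.getVert_copy,
      SimpleGraph.Walk.take_getVert, SimpleGraph.Walk.drop_getVert] at hj heq ⊢
    have e : (tau p h - tauStar p h) ⊓ (p.length - tauStar p h) = tau p h - tauStar p h := by
      omega
    rw [e] at hj ⊢
    rw [min_eq_right hj, min_eq_right (hij.le.trans hj)] at heq
    have h3 : tau p h ≤ tauStar p h + j :=
      Nat.find_min' (exists_repeat h) ⟨by omega, tauStar p h + i, by omega, heq.symm⟩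
    have h4 : tauStar p h + j = tau p h := by omega
    rw [h4] at heq
    have h5 := getVert_tauStar p h
    refine ⟨?_, by omega⟩
    by_contra hi
    have h6 : tau p h ≤ tauStar p h + i :=
      Nat.find_min' (exists_repeat h) ⟨by omega, tauStar p h, by omega, by rw [heq, h5]⟩
    omega

/-- The loop erasure: single loop erasures are applied until the walk is self-avoiding. -/
def loopErase (p : G.Walk u v) : G.Walk u v :=
  if h : p.IsPath then p else loopErase (eraseOnce p h)
termination_by p.length
decreasing_by exact length_eraseOnce_lt p h

/-- The multiset of the self-avoiding polygons removed in the course of the loop erasure. -/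
def removedLoops (p : G.Walk u v) : Multiset (SAPolygon G) :=
  if h : p.IsPath then 0 else removedLoop p h ::ₘ removedLoops (eraseOnce p h)
termination_by p.length
decreasing_by exact length_eraseOnce_lt p h

end LoopErasure

noncomputable section Weights

variable {V : Type*} [DecidableEq V] {G : SimpleGraph V} {u v : V}

open scoped Classical in
/-- The loop vector `n_L(ω)`: its coordinate at `η` is the number of times that `η` is removed
by the loop erasure of `ω`. -/
def loopVector (ω : G.Walk u v) : SAPolygon G →₀ ℕ :=
  Multiset.toFinsupp (removedLoops ω)

/-- The weight `w_{λ,z}(ω) = z ^ |ω| ∏_η λ_η ^ n_L^η(ω)`. -/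
def weight (lam : SAPolygon G → ℝ≥0) (z : ℝ≥0) (ω : G.Walk u v) : ℝ≥0 :=
  z ^ ω.length * (loopVector ω).prod fun η n => lam η ^ n

/-- The activities do not depend on the initial vertex of an oriented polygon. -/
def RotationInvariant (lam : SAPolygon G → ℝ≥0) : Prop :=
  ∀ η η' : SAPolygon G,
    (∃ h : η'.base ∈ η.walk.support, η.walk.rotate η'.base h = η'.walk) → lam η' = lam η

open scoped Classical in
/-- The loop-erased weight of `η`: the total weight of the walks with loop erasure `η` if `η` is
self-avoiding, and `0` otherwise. Loop erasure keeps both endpoints, so only walks between the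
endpoints of `η` are summed over. -/
def loopErasedWeight (lam : SAPolygon G → ℝ≥0) (z : ℝ≥0) (η : G.Walk u v) : ℝ≥0∞ :=
  if η.IsPath then ∑' ω : {ω : G.Walk u v // loopErase ω = η}, (weight lam z ω.1 : ℝ≥0∞) else 0

/-- The set of vertices visited by a walk. -/
def range (ω : G.Walk u v) : Set V := {x | x ∈ ω.support}

open scoped Classical in
/-- The loop measure `μ_{λ,z}(A; B)`: the sum of `w_{λ,z}(ω) / |ω|` over all closed walks `ω`
with at least one step that hit `A` and avoid `B`. -/
def loopMeasureAvoiding (lam : SAPolygon G → ℝ≥0) (z : ℝ≥0) (A B : Set V) : ℝ≥0∞ :=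
  ∑' (x : V) (ω : G.Walk x x),
    if 1 ≤ ω.length ∧ (range ω ∩ A).Nonempty ∧ range ω ∩ B = ∅ then
      (weight lam z ω : ℝ≥0∞) / (ω.length : ℝ≥0∞)
    else 0

/-- `μ_{λ,z}(A) = μ_{λ,z}(A; ∅)`. -/
def loopMeasure (lam : SAPolygon G → ℝ≥0) (z : ℝ≥0) (A : Set V) : ℝ≥0∞ :=
  loopMeasureAvoiding lam z A ∅

/-- The susceptibility: the total weight of all walks that begin at `x`. -/
def susceptibility (lam : SAPolygon G → ℝ≥0) (z : ℝ≥0) (x : V) : ℝ≥0∞ :=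
  ∑' (y : V) (ω : G.Walk x y), (weight lam z ω : ℝ≥0∞)

end Weights

end LWW

/-! For `U ⊆ V` let `Γ_U(x)` be the series, with `X` marking steps, of the closed walks at `x` in
`U` weighted by activities, and `F` that of the first-return loops; then `Γ = 1 / (1 - F)`. Cutting
a walk at its last visit to `η_0` shows that the walks with loop erasure `η` have series `X^|η| ∏
Γ_{U_i}(η_i)`, where `U_i` is `U` without `η_0, …, η_{i-1}` (`erasedGen_cons`). The loop measure
splits likewise, by the smallest `i` for which a loop hits `η_i` (`loopMeasureAvoiding_range_cons`).
It remains to see that `exp μ({x}; Uᶜ) = Γ_U(x)` at `z`.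

In other words, the closed walks through `x`, started anywhere in `U` and weighted by `1 / |ω|`,
must sum to `-log (1 - F)`. The removed polygons depend on the starting point, so a cyclic shift of
walks does not prove this. For finite `S` let `D_S` be the alternating sum over families of disjoint
oriented polygons in `S`. The last loop removed from a first-return loop at `x` is a polygon through
`x`; by induction this gives `D_S = D_{S \ x} (1 - F)`, that is, `Γ_S(x) D_S = D_{S \ x}`
(`realSeries_closedGen_mul_polygonDet`).

The Euler derivation `θ = X d/dX` multiplies each term of `D_S` by the number of vertices covered,
so `θ D_S = D_S ∑_y (1 - Γ_S(y))`. Comparing `S` with `S \ x`, the closed walks through `x` have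
total series `1 + Γ θF` (`sum_throughGen_eq`). Dividing the `N`-th coefficient of `Γ θF` by `N`
gives `-log (1 - F)` (`tsum_evalAt_pow_div`). Monotone convergence along finite subsets extends the
result to every `U`. -/

namespace LWW

/-! ### Loop erasure of concatenated walks -/

section LoopErasure

variable {V : Type*} {G : SimpleGraph V} {u v w : V}

theorem SAPolygon.ext_support {γ γ' : SAPolygon G} (h : γ.walk.support = γ'.walk.support) :
    γ = γ' := by
  obtain ⟨x, c, h1, h2⟩ := γ
  obtain ⟨x', c', h1', h2'⟩ := γ'
  simp only at h
  have hx : x = x' := by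
    have h3 := c.head_support
    have h4 := c'.head_support
    simp only [h] at h3
    exact h3.symm.trans h4
  subst hx
  obtain rfl := SimpleGraph.Walk.ext_support h
  rfl

theorem getVert_append_of_le (c : G.Walk u v) (q : G.Walk v w) {i : ℕ} (hi : i ≤ c.length) :
    (c.append q).getVert i = c.getVert i := by
  rw [SimpleGraph.Walk.getVert_append]
  split_ifs with h
  · rfl
  · obtain rfl : i = c.length := by omega
    simp

theorem not_isPath_append (c : G.Walk u v) (q : G.Walk v w) (h : ¬ c.IsPath) :
    ¬ (c.append q).IsPath := fun h' => h h'.of_append_left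

theorem not_isPath_cons (hu : G.Adj u v) (p : G.Walk v w) (h : ¬ p.IsPath) :
    ¬ (p.cons hu).IsPath := fun h' => h h'.of_cons

/-- A closed walk is a polygon if it has a step and its vertices, the initial one excepted, are
distinct. -/
def IsPolygon (c : G.Walk u u) : Prop := 0 < c.length ∧ c.support.tail.Nodup

theorem isPolygon_iff {c : G.Walk u u} : IsPolygon c ↔ 0 < c.length ∧
    ∀ i j : ℕ, i < j → j ≤ c.length → c.getVert i = c.getVert j → i = 0 ∧ j = c.length := by
  refine and_congr_right fun hc => ?_
  have key : ∀ i, i < c.support.tail.length ↔ i + 1 ≤ c.length := by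
    intro i; simp [c.length_support]
  have get : ∀ i (hi : i < c.support.tail.length), c.support.tail[i] = c.getVert (i + 1) := by
    intro i hi
    rw [List.getElem_tail, c.support_getElem_eq_getVert]
  rw [List.nodup_iff_pairwise_ne, List.pairwise_iff_getElem]
  constructor
  · intro hnd i j hij hj e
    obtain ⟨j, rfl⟩ : ∃ k, j = k + 1 := ⟨j - 1, by omega⟩
    rcases i with _ | i
    · refine ⟨rfl, ?_⟩
      by_contra hne
      obtain ⟨n, hn⟩ : ∃ k, c.length = k + 1 := ⟨c.length - 1, by omega⟩
      refine hnd j n ((key _).2 hj) ((key _).2 hn.ge) (by omega) ?_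
      rw [get, get, ← e, ← hn]
      simp
    · refine absurd ?_ (hnd i j ((key _).2 (by omega)) ((key _).2 hj) (by omega))
      rw [get, get, e]
  · intro hsa i j hi hj hij e
    rw [get, get] at e
    exact absurd (hsa (i + 1) (j + 1) (by omega) ((key _).1 hj) e).1 (by omega)

/-- The self-avoiding polygon given by a closed walk. -/
def IsPolygon.toSAPolygon {c : G.Walk u u} (hc : IsPolygon c) : SAPolygon G where
  base := u
  walk := c
  length_pos := (isPolygon_iff.1 hc).1
  selfAvoiding := (isPolygon_iff.1 hc).2

theorem isPolygon_cons_concat {x a b : V} (ha : G.Adj x a) (hb : G.Adj b x) {η : G.Walk a b}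
    (hη : η.IsPath) (hx : x ∉ η.support) : IsPolygon ((η.concat hb).cons ha) := by
  refine ⟨by simp, ?_⟩
  rw [SimpleGraph.Walk.support_cons, List.tail_cons, SimpleGraph.Walk.support_concat,
    List.nodup_append]
  exact ⟨hη.support_nodup, by simp, by simpa using fun y hy (e : y = x) => hx (e ▸ hy)⟩

variable [DecidableEq V]

theorem tau_eq (p : G.Walk u v) (h : ¬ p.IsPath) {i j : ℕ} (hi : i ≤ p.length) (hj : j < i)
    (hij : p.getVert i = p.getVert j)
    (hmin : ∀ k < i, ∀ l < k, p.getVert k ≠ p.getVert l) : tau p h = i := by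
  refine (Nat.find_eq_iff _).2 ⟨⟨hi, j, hj, hij⟩, ?_⟩
  rintro k hk ⟨-, l, hl, hkl⟩
  exact hmin k hk l hl hkl

theorem tauStar_eq (p : G.Walk u v) (h : ¬ p.IsPath) {j : ℕ}
    (hj : p.getVert j = p.getVert (tau p h))
    (hmin : ∀ k < j, p.getVert k ≠ p.getVert (tau p h)) : tauStar p h = j :=
  (Nat.find_eq_iff (p := fun j => p.getVert j = p.getVert (tau p h)) _).2 ⟨hj, hmin⟩

theorem getVert_ne_of_lt_tau (p : G.Walk u v) (h : ¬ p.IsPath) {k l : ℕ} (hk : k < tau p h)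
    (hl : l < k) : p.getVert k ≠ p.getVert l := fun hkl =>
  Nat.find_min (exists_repeat h) hk ⟨hk.le.trans (tau_le_length p h), l, hl, hkl⟩

theorem getVert_ne_of_lt_tauStar (p : G.Walk u v) (h : ¬ p.IsPath) {k : ℕ}
    (hk : k < tauStar p h) : p.getVert k ≠ p.getVert (tau p h) :=
  Nat.find_min (p := fun j => p.getVert j = p.getVert (tau p h)) _ hk

theorem support_eraseOnce (p : G.Walk u v) (h : ¬ p.IsPath) :
    (eraseOnce p h).support =
      p.support.take (tauStar p h + 1) ++ p.support.drop (tau p h + 1) := by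
  have h2 := tau_le_length p h
  rw [eraseOnce, SimpleGraph.Walk.support_append, SimpleGraph.Walk.support_copy,
    SimpleGraph.Walk.support_take, SimpleGraph.Walk.drop_support_eq_support_drop_min,
    min_eq_left h2, List.tail_drop]

theorem support_eraseOnce_subset (p : G.Walk u v) (h : ¬ p.IsPath) :
    (eraseOnce p h).support ⊆ p.support := by
  rw [support_eraseOnce]
  exact List.append_subset.2 ⟨List.take_subset _ _, List.drop_subset _ _⟩

theorem support_removedLoop (p : G.Walk u v) (h : ¬ p.IsPath) :
    (removedLoop p h).walk.support =
      (p.support.drop (tauStar p h)).take (tau p h - tauStar p h + 1) := by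
  have h1 := tauStar_lt_tau p h
  have h2 := tau_le_length p h
  simp only [removedLoop, SimpleGraph.Walk.support_copy, SimpleGraph.Walk.support_take,
    SimpleGraph.Walk.drop_support_eq_support_drop_min]
  rw [min_eq_left (by omega)]

section Append

variable (c : G.Walk u v) (q : G.Walk v w) (h : ¬ c.IsPath)

theorem tau_append : tau (c.append q) (not_isPath_append c q h) = tau c h := by
  have h1 := tauStar_lt_tau c h
  have h2 := tau_le_length c h
  refine tau_eq _ _ (j := tauStar c h) ?_ h1 ?_ ?_
  · rw [SimpleGraph.Walk.length_append]; omega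
  · rw [getVert_append_of_le _ _ h2, getVert_append_of_le _ _ (by omega), getVert_tauStar]
  · intro k hk l hl
    rw [getVert_append_of_le _ _ (by omega), getVert_append_of_le _ _ (by omega)]
    exact getVert_ne_of_lt_tau c h hk hl

theorem tauStar_append : tauStar (c.append q) (not_isPath_append c q h) = tauStar c h := by
  have h1 := tauStar_lt_tau c h
  have h2 := tau_le_length c h
  refine tauStar_eq _ _ ?_ ?_
  · rw [tau_append c q h, getVert_append_of_le _ _ h2, getVert_append_of_le _ _ (by omega),
      getVert_tauStar]
  · intro k hk
    rw [tau_append c q h, getVert_append_of_le _ _ h2, getVert_append_of_le _ _ (by omega)]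
    exact getVert_ne_of_lt_tauStar c h hk

theorem eraseOnce_append :
    eraseOnce (c.append q) (not_isPath_append c q h) = (eraseOnce c h).append q := by
  have h1 := tauStar_lt_tau c h
  have h2 := tau_le_length c h
  have h3 := c.length_support
  apply SimpleGraph.Walk.ext_support
  rw [SimpleGraph.Walk.support_append, support_eraseOnce, support_eraseOnce, tau_append,
    tauStar_append, SimpleGraph.Walk.support_append, List.take_append_of_le_length (by omega),
    List.drop_append_of_le_length (by omega), List.append_assoc]

theorem removedLoop_append :
    removedLoop (c.append q) (not_isPath_append c q h) = removedLoop c h := by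
  have h1 := tauStar_lt_tau c h
  have h2 := tau_le_length c h
  have h3 := c.length_support
  apply SAPolygon.ext_support
  rw [support_removedLoop, support_removedLoop, tau_append, tauStar_append,
    SimpleGraph.Walk.support_append, List.drop_append_of_le_length (by omega),
    List.take_append_of_le_length (by rw [List.length_drop]; omega)]

end Append

theorem loopErase_of_isPath {p : G.Walk u v} (h : p.IsPath) : loopErase p = p := by
  rw [loopErase, dif_pos h]

theorem loopErase_of_not_isPath {p : G.Walk u v} (h : ¬ p.IsPath) :
    loopErase p = loopErase (eraseOnce p h) := by
  rw [loopErase, dif_neg h]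

theorem removedLoops_of_isPath {p : G.Walk u v} (h : p.IsPath) : removedLoops p = 0 := by
  rw [removedLoops, dif_pos h]

theorem removedLoops_of_not_isPath {p : G.Walk u v} (h : ¬ p.IsPath) :
    removedLoops p = removedLoop p h ::ₘ removedLoops (eraseOnce p h) := by
  rw [removedLoops, dif_neg h]

/-- Induction along the single loop erasures of a walk. -/
theorem eraseOnce_induction {P : G.Walk u v → Prop} (path : ∀ p, p.IsPath → P p)
    (step : ∀ (p) (h : ¬ p.IsPath), P (eraseOnce p h) → P p) (p : G.Walk u v) : P p := by
  induction hn : p.length using Nat.strong_induction_on generalizing p with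
  | _ n ih =>
    subst hn
    by_cases h : p.IsPath
    · exact path p h
    · exact step p h (ih _ (length_eraseOnce_lt p h) _ rfl)

theorem isPath_loopErase (p : G.Walk u v) : (loopErase p).IsPath := by
  induction p using eraseOnce_induction with
  | path p h => rwa [loopErase_of_isPath h]
  | step p h ih => rwa [loopErase_of_not_isPath h]

theorem support_loopErase_subset (p : G.Walk u v) : (loopErase p).support ⊆ p.support := by
  induction p using eraseOnce_induction with
  | path p h => rw [loopErase_of_isPath h]; exact List.Subset.refl _
  | step p h ih =>
    rw [loopErase_of_not_isPath h]
    exact List.Subset.trans ih (support_eraseOnce_subset p h)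

theorem loopErase_closed (c : G.Walk u u) : loopErase c = SimpleGraph.Walk.nil :=
  (SimpleGraph.Walk.isPath_iff_nil.1 (isPath_loopErase c)).eq_nil

/-- The earliest repetition is the one erased, so all erasures within the prefix `c` take place
before `q` matters. -/
theorem loopErase_append (c : G.Walk u v) (q : G.Walk v w) :
    loopErase (c.append q) = loopErase ((loopErase c).append q) := by
  induction c using eraseOnce_induction with
  | path c h => rw [loopErase_of_isPath h]
  | step c h ih =>
    rw [loopErase_of_not_isPath (not_isPath_append c q h), eraseOnce_append c q h, ih,
      loopErase_of_not_isPath h]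

theorem removedLoops_append (c : G.Walk u v) (q : G.Walk v w) :
    removedLoops (c.append q) =
      removedLoops c + removedLoops ((loopErase c).append q) := by
  induction c using eraseOnce_induction with
  | path c h => rw [loopErase_of_isPath h, removedLoops_of_isPath h, zero_add]
  | step c h ih =>
    rw [removedLoops_of_not_isPath (not_isPath_append c q h), eraseOnce_append c q h, ih,
      loopErase_of_not_isPath h, removedLoop_append c q h, removedLoops_of_not_isPath h,
      Multiset.cons_add]

section Cons

variable (hu : G.Adj u v) (p : G.Walk v w) (h : ¬ p.IsPath)

theorem tau_cons (hp : u ∉ p.support) : tau (p.cons hu) (not_isPath_cons hu p h) = tau p h + 1 := by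
  have h1 := tauStar_lt_tau p h
  have h2 := tau_le_length p h
  refine tau_eq _ _ (j := tauStar p h + 1) ?_ (by omega) ?_ ?_
  · rw [SimpleGraph.Walk.length_cons]; omega
  · simp [getVert_tauStar]
  · rintro (_ | k) hk (_ | l) hl
    · omega
    · omega
    · simp only [SimpleGraph.Walk.getVert_cons_succ, SimpleGraph.Walk.getVert_zero]
      exact fun e => hp (e ▸ p.getVert_mem_support k)
    · simp only [SimpleGraph.Walk.getVert_cons_succ]
      exact getVert_ne_of_lt_tau p h (by omega) (by omega)

theorem tauStar_cons (hp : u ∉ p.support) : tauStar (p.cons hu) (not_isPath_cons hu p h) = tauStar p h + 1 := by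
  refine tauStar_eq _ _ ?_ ?_
  · rw [tau_cons hu p h hp]
    simp [getVert_tauStar]
  · rw [tau_cons hu p h hp]
    rintro (_ | k) hk
    · simp only [SimpleGraph.Walk.getVert_cons_succ, SimpleGraph.Walk.getVert_zero]
      exact fun e => hp (e ▸ p.getVert_mem_support _)
    · simp only [SimpleGraph.Walk.getVert_cons_succ]
      exact getVert_ne_of_lt_tauStar p h (by omega)

theorem eraseOnce_cons (hp : u ∉ p.support) :
    eraseOnce (p.cons hu) (not_isPath_cons hu p h) = (eraseOnce p h).cons hu := by
  apply SimpleGraph.Walk.ext_support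
  rw [support_eraseOnce, tau_cons hu p h hp, tauStar_cons hu p h hp]
  simp [support_eraseOnce]

theorem removedLoop_cons (hp : u ∉ p.support) :
    removedLoop (p.cons hu) (not_isPath_cons hu p h) = removedLoop p h := by
  apply SAPolygon.ext_support
  rw [support_removedLoop, support_removedLoop, tau_cons hu p h hp, tauStar_cons hu p h hp]
  simp

end Cons

/-- The vertex `u` is never revisited and takes part in no repetition; prefixing it only shifts
`tau` and `tauStar` by one. -/
theorem loopErase_cons (hu : G.Adj u v) (p : G.Walk v w) (hp : u ∉ p.support) :
    loopErase (p.cons hu) = (loopErase p).cons hu := by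
  induction p using eraseOnce_induction with
  | path p h => rw [loopErase_of_isPath h, loopErase_of_isPath (h.cons hp)]
  | step p h ih =>
    rw [loopErase_of_not_isPath (not_isPath_cons hu p h), eraseOnce_cons hu p h hp,
      ih fun e => hp (support_eraseOnce_subset p h e), loopErase_of_not_isPath h]

theorem removedLoops_cons (hu : G.Adj u v) (p : G.Walk v w) (hp : u ∉ p.support) :
    removedLoops (p.cons hu) = removedLoops p := by
  induction p using eraseOnce_induction with
  | path p h => rw [removedLoops_of_isPath h, removedLoops_of_isPath (h.cons hp)]
  | step p h ih =>
    rw [removedLoops_of_not_isPath (not_isPath_cons hu p h), eraseOnce_cons hu p h hp,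
      ih fun e => hp (support_eraseOnce_subset p h e), removedLoop_cons hu p h hp,
      removedLoops_of_not_isPath h]

/-- The closing of the polygon is its only repetition, so `tau` is the length and `tauStar` is `0`;
one erasure leaves the trivial walk. -/
theorem removedLoops_of_isPolygon {c : G.Walk u u} (hc : IsPolygon c) :
    removedLoops c = {hc.toSAPolygon} := by
  obtain ⟨h0, hsa⟩ := isPolygon_iff.1 hc
  have hn : ¬ c.IsPath := by
    intro h
    simp [(SimpleGraph.Walk.isPath_iff_nil.1 h).eq_nil] at h0
  have ht : tau c hn = c.length := by
    refine tau_eq c hn (j := 0) le_rfl h0 (by simp) ?_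
    intro k hk l hl e
    have := (hsa l k hl hk.le e.symm).2
    omega
  have hs : tauStar c hn = 0 := by
    refine tauStar_eq c hn ?_ (by simp)
    rw [ht]; simp
  rw [removedLoops_of_not_isPath hn, removedLoops_of_isPath]
  · rw [Multiset.cons_zero]
    congr 1
    apply SAPolygon.ext_support
    rw [support_removedLoop, ht, hs]
    simp [IsPolygon.toSAPolygon, List.take_of_length_le]
  · rw [SimpleGraph.Walk.isPath_def, support_eraseOnce, ht, hs, ← c.length_support,
      List.drop_length]
    refine (List.append_nil _).symm ▸ ?_
    cases hcs : c.support <;> simp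

theorem removedLoops_closed_append (c : G.Walk u u) (q : G.Walk u v) :
    removedLoops (c.append q) = removedLoops c + removedLoops q := by
  rw [removedLoops_append, loopErase_closed, SimpleGraph.Walk.nil_append]

theorem loopErase_closed_append (c : G.Walk u u) (q : G.Walk u v) :
    loopErase (c.append q) = loopErase q := by
  rw [loopErase_append, loopErase_closed, SimpleGraph.Walk.nil_append]

/-- Before the final step back to `x` the walk has been reduced to `x` followed by `loopErase q`;
that step closes a polygon, the last loop to be removed. -/
theorem removedLoops_cons_concat {x a b : V} (ha : G.Adj x a) (hb : G.Adj b x) (q : G.Walk a b)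
    (hx : x ∉ q.support) :
    removedLoops ((q.concat hb).cons ha) = removedLoops q +
      {(isPolygon_cons_concat ha hb (isPath_loopErase q)
        fun e => hx (support_loopErase_subset q e)).toSAPolygon} := by
  rw [SimpleGraph.Walk.concat_eq_append, ← SimpleGraph.Walk.cons_append, removedLoops_append,
    removedLoops_cons ha q hx, loopErase_cons ha q hx, SimpleGraph.Walk.cons_append,
    ← SimpleGraph.Walk.concat_eq_append, removedLoops_of_isPolygon]

end LoopErasure

end LWW

/-! ### Alternating sums over families of disjoint sets -/

namespace LWW

noncomputable section DisjointFamilies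

variable {V : Type*} [DecidableEq V] {R : Type*} [CommRing R]

/-- The families of pairwise disjoint nonempty subsets of `S`. -/
def disjointFamilies (S : Finset V) : Finset (Finset (Finset V)) :=
  S.powerset.powerset.filter fun π => ∅ ∉ π ∧ ∀ A ∈ π, ∀ B ∈ π, A ≠ B → Disjoint A B

theorem mem_disjointFamilies {S : Finset V} {π : Finset (Finset V)} :
    π ∈ disjointFamilies S ↔
      (∀ A ∈ π, A ⊆ S) ∧ ∅ ∉ π ∧ ∀ A ∈ π, ∀ B ∈ π, A ≠ B → Disjoint A B := by
  simp only [disjointFamilies, Finset.mem_filter, Finset.mem_powerset]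
  refine and_congr_left' ⟨fun h A hA => Finset.mem_powerset.1 (h hA),
    fun h A hA => Finset.mem_powerset.2 (h A hA)⟩

/-- The alternating sum of `∏ q A` over the families of disjoint nonempty subsets of `S`. -/
def disjointSum (q : Finset V → R) (S : Finset V) : R :=
  ∑ π ∈ disjointFamilies S, ∏ A ∈ π, -q A

/-- Marking a member `A` of a family leaves a family of disjoint subsets of `S \ A`; the sign comes
from the factor `-q A`. -/
theorem sum_disjointFamilies_sum (q f : Finset V → R) (S : Finset V) :
    ∑ π ∈ disjointFamilies S, ∑ A ∈ π, f A * ∏ B ∈ π, -q B =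
      -∑ A ∈ S.powerset.erase ∅, f A * (q A * disjointSum q (S \ A)) := by
  simp only [disjointSum, Finset.mul_sum, ← Finset.sum_neg_distrib]
  rw [Finset.sum_sigma', Finset.sum_sigma']
  refine Finset.sum_bij' (fun s _ => ⟨s.2, s.1.erase s.2⟩) (fun t _ => ⟨insert t.1 t.2, t.1⟩)
    ?_ ?_ ?_ ?_ ?_
  · rintro ⟨π, A⟩ h
    simp only [Finset.mem_sigma, mem_disjointFamilies] at h ⊢
    obtain ⟨⟨h1, h2, h3⟩, hA⟩ := h
    refine ⟨Finset.mem_erase.2 ⟨fun e => h2 (e ▸ hA), Finset.mem_powerset.2 (h1 A hA)⟩,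
      fun B hB => ?_, fun hB => h2 (Finset.mem_of_mem_erase hB),
      fun B hB C hC => h3 B (Finset.mem_of_mem_erase hB) C (Finset.mem_of_mem_erase hC)⟩
    have hB' := Finset.mem_erase.1 hB
    exact Finset.subset_sdiff.2 ⟨h1 B hB'.2, h3 B hB'.2 A hA hB'.1⟩
  · rintro ⟨A, π⟩ h
    simp only [Finset.mem_sigma, mem_disjointFamilies] at h ⊢
    obtain ⟨hA, h1, h2, h3⟩ := h
    obtain ⟨hA0, hAS⟩ := Finset.mem_erase.1 hA
    have hAS := Finset.mem_powerset.1 hAS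
    refine ⟨⟨?_, ?_, ?_⟩, Finset.mem_insert_self _ _⟩
    · intro B hB
      rcases Finset.mem_insert.1 hB with rfl | hB
      · exact hAS
      · exact (h1 B hB).trans Finset.sdiff_subset
    · intro hB
      rcases Finset.mem_insert.1 hB with hB | hB
      · exact hA0 hB.symm
      · exact h2 hB
    · intro B hB C hC hBC
      rcases Finset.mem_insert.1 hB with hB' | hB' <;>
        rcases Finset.mem_insert.1 hC with hC' | hC'
      · exact absurd (hB'.trans hC'.symm) hBC
      · exact hB' ▸ (Finset.subset_sdiff.1 (h1 C hC')).2.symm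
      · exact hC' ▸ (Finset.subset_sdiff.1 (h1 B hB')).2
      · exact h3 B hB' C hC' hBC
  · rintro ⟨π, A⟩ h
    simp only [Finset.mem_sigma] at h
    simp only [Finset.insert_erase h.2]
  · rintro ⟨A, π⟩ h
    simp only [Finset.mem_sigma, mem_disjointFamilies] at h
    have hA : A ∉ π := by
      intro hA
      have h5 := Finset.subset_sdiff.1 (h.2.1 A hA)
      rw [disjoint_self] at h5
      exact h.2.2.1 (by simpa [h5.2] using hA)
    simp only [Finset.erase_insert hA]
  · rintro ⟨π, A⟩ h
    simp only [Finset.mem_sigma] at h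
    simp only
    rw [← Finset.mul_prod_erase π _ h.2]
    ring

/-- A family either misses `x` or, by disjointness, has exactly one member containing it. Marking
with the indicator of `x ∈ A` therefore selects the families that cover `x`. -/
theorem disjointSum_eq (q : Finset V → R) {S : Finset V} {x : V} :
    disjointSum q S = disjointSum q (S.erase x) -
      ∑ A ∈ S.powerset with x ∈ A, q A * disjointSum q (S \ A) := by
  have h := sum_disjointFamilies_sum q (fun A => if x ∈ A then 1 else 0) S
  have h1 : ∑ A ∈ S.powerset.erase ∅, (if x ∈ A then (1 : R) else 0) *
      (q A * disjointSum q (S \ A)) =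
      ∑ A ∈ S.powerset with x ∈ A, q A * disjointSum q (S \ A) := by
    rw [Finset.sum_filter, Finset.sum_erase]
    · exact Finset.sum_congr rfl fun A _ => by split_ifs <;> simp
    · simp
  rw [h1] at h
  rw [sub_eq_add_neg, ← h, disjointSum, disjointSum,
    ← Finset.sum_filter_add_sum_filter_not (disjointFamilies S) fun π => ∀ A ∈ π, x ∉ A]
  congr 1
  · refine Finset.sum_congr (Finset.ext fun π => ?_) fun _ _ => rfl
    simp only [Finset.mem_filter, mem_disjointFamilies, Finset.subset_erase]
    constructor
    · rintro ⟨⟨h1, h2, h3⟩, h4⟩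
      exact ⟨fun A hA => ⟨h1 A hA, h4 A hA⟩, h2, h3⟩
    · rintro ⟨h1, h2, h3⟩
      exact ⟨⟨fun A hA => (h1 A hA).1, h2, h3⟩, fun A hA => (h1 A hA).2⟩
  · rw [Finset.sum_filter]
    refine Finset.sum_congr rfl fun π hπ => ?_
    rw [← Finset.sum_mul]
    by_cases hx : ∀ A ∈ π, x ∉ A
    · rw [if_neg (not_not.2 hx), Finset.sum_eq_zero fun A hA => if_neg (hx A hA), zero_mul]
    · rw [if_pos hx]
      push Not at hx
      obtain ⟨A, hA, hxA⟩ := hx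
      rw [Finset.sum_eq_single_of_mem A hA, if_pos hxA, one_mul]
      intro B hB hBA
      rw [if_neg]
      intro hxB
      exact Finset.disjoint_left.1 ((mem_disjointFamilies.1 hπ).2.2 B hB A hA hBA) hxB hxA

theorem disjointSum_empty (q : Finset V → R) : disjointSum q ∅ = 1 := by
  have : disjointFamilies (∅ : Finset V) = {∅} := by
    ext π
    rw [mem_disjointFamilies, Finset.mem_singleton]
    constructor
    · rintro ⟨h1, h2, -⟩
      refine Finset.eq_empty_of_forall_notMem fun A hA => h2 ?_
      rwa [← Finset.subset_empty.1 (h1 A hA)]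
    · rintro rfl
      simp
  simp [disjointSum, this]

/-- The term of a family is an eigenvector of `d`, with the number of covered vertices as
eigenvalue. The difference for `y` collects the families covering `y`, so the sum over `y` counts
each family with the same multiplicity. -/
theorem derivation_disjointSum {k : Type*} [CommRing k] [Algebra k R] (d : Derivation k R R)
    (q : Finset V → R) (hq : ∀ A, d (q A) = A.card * q A) (S : Finset V) :
    d (disjointSum q S) = ∑ y ∈ S, (disjointSum q S - disjointSum q (S.erase y)) := by
  have hprod : ∀ π : Finset (Finset V),
      d (∏ A ∈ π, -q A) = ∑ A ∈ π, (A.card : R) * ∏ B ∈ π, -q B := by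
    intro π
    induction π using Finset.induction_on with
    | empty => simp
    | insert A π hA ih =>
      rw [Finset.prod_insert hA, Derivation.leibniz, ih, map_neg, hq, Finset.sum_insert hA,
        smul_eq_mul, smul_eq_mul, Finset.mul_sum]
      rw [add_comm]
      congr 1
      · ring
      · exact Finset.sum_congr rfl fun B _ => by ring
  have hy : ∀ y ∈ S, disjointSum q S - disjointSum q (S.erase y) =
      -∑ A ∈ S.powerset, if y ∈ A then q A * disjointSum q (S \ A) else 0 := by
    intro y _
    rw [disjointSum_eq q (x := y), Finset.sum_filter]
    ring
  rw [disjointSum, map_sum, Finset.sum_congr rfl fun π _ => hprod π, ← disjointSum,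
    sum_disjointFamilies_sum q (fun A => (A.card : R)), Finset.sum_congr rfl hy,
    Finset.sum_neg_distrib, Finset.sum_comm, Finset.sum_erase _ (by simp)]
  congr 1
  refine Finset.sum_congr rfl fun A hA => ?_
  rw [← Finset.sum_filter, Finset.sum_const, nsmul_eq_mul, Finset.filter_mem_eq_inter,
    Finset.inter_eq_right.2 (Finset.mem_powerset.1 hA)]

end DisjointFamilies

end LWW

/-! ### Generating functions with coefficients in `[0, ∞]` -/

namespace LWW

noncomputable section GeneratingFunctions

open PowerSeries

/-- The generating function `∑ w a X ^ ℓ a` of a weighted family of objects. -/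
def genFun {α : Type*} (ℓ : α → ℕ) (w : α → ℝ≥0∞) : ℝ≥0∞⟦X⟧ :=
  PowerSeries.mk fun n => ∑' a, if ℓ a = n then w a else 0

theorem coeff_genFun {α : Type*} (ℓ : α → ℕ) (w : α → ℝ≥0∞) (n : ℕ) :
    coeff n (genFun ℓ w) = ∑' a, if ℓ a = n then w a else 0 := coeff_mk _ _

theorem genFun_of_bijective {α β : Type*} {ℓ : α → ℕ} {w : α → ℝ≥0∞} {ℓ' : β → ℕ}
    {w' : β → ℝ≥0∞} (f : α → β) (hf : f.Bijective) (hℓ : ∀ a, ℓ' (f a) = ℓ a)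
    (hw : ∀ a, w' (f a) = w a) : genFun ℓ w = genFun ℓ' w' := by
  ext n
  rw [coeff_genFun, coeff_genFun, ← (Equiv.ofBijective f hf).tsum_eq]
  simp [hℓ, hw]

theorem genFun_prod {α β : Type*} (ℓ : α → ℕ) (w : α → ℝ≥0∞) (ℓ' : β → ℕ) (w' : β → ℝ≥0∞) :
    genFun (fun p : α × β => ℓ p.1 + ℓ' p.2) (fun p => w p.1 * w' p.2) =
      genFun ℓ w * genFun ℓ' w' := by
  ext n
  rw [coeff_mul, coeff_genFun, ENNReal.tsum_prod']
  simp only [coeff_genFun, ← ENNReal.tsum_mul_left, ← ENNReal.tsum_mul_right]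
  rw [← Summable.tsum_finsetSum fun _ _ => ENNReal.summable]
  rw [ENNReal.tsum_comm]
  refine tsum_congr fun b => ?_
  rw [← Summable.tsum_finsetSum fun _ _ => ENNReal.summable]
  refine tsum_congr fun a => ?_
  simp only [mul_ite, ite_mul, mul_zero, zero_mul]
  by_cases h : ℓ a + ℓ' b = n
  · rw [if_pos h, Finset.sum_eq_single_of_mem (ℓ a, ℓ' b) (Finset.HasAntidiagonal.mem_antidiagonal.2 h)]
    · simp
    · rintro ⟨i, j⟩ _ hne
      simp only [ne_eq, Prod.mk.injEq, not_and] at hne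
      split_ifs with h1 h2 <;> simp_all
  · rw [if_neg h, eq_comm]
    refine Finset.sum_eq_zero ?_
    rintro ⟨i, j⟩ hij
    rw [Finset.HasAntidiagonal.mem_antidiagonal] at hij
    simp only at hij ⊢
    split_ifs with h1 h2 <;> simp_all

theorem genFun_sum {α β : Type*} (ℓ : α ⊕ β → ℕ) (w : α ⊕ β → ℝ≥0∞) :
    genFun ℓ w = genFun (fun a => ℓ (Sum.inl a)) (fun a => w (Sum.inl a)) +
      genFun (fun b => ℓ (Sum.inr b)) (fun b => w (Sum.inr b)) := by
  ext n
  simp only [map_add, coeff_genFun]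
  exact Summable.tsum_sum ENNReal.summable ENNReal.summable

theorem genFun_unit : genFun (fun _ : Unit => 0) (fun _ => 1) = 1 := by
  ext n
  simp [coeff_genFun, coeff_one, eq_comm]

theorem genFun_sigma {ι : Type*} [Fintype ι] {α : ι → Type*} (ℓ : (Σ i, α i) → ℕ)
    (w : (Σ i, α i) → ℝ≥0∞) :
    genFun ℓ w = ∑ i, genFun (fun a => ℓ ⟨i, a⟩) (fun a => w ⟨i, a⟩) := by
  ext n
  simp only [map_sum, coeff_genFun]
  rw [ENNReal.tsum_sigma', tsum_fintype]

theorem genFun_shift {α : Type*} (ℓ : α → ℕ) (w : α → ℝ≥0∞) (c : ℝ≥0∞) (k : ℕ) :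
    genFun (fun a => ℓ a + k) (fun a => c * w a) = C c * X ^ k * genFun ℓ w := by
  ext n
  rw [mul_assoc, coeff_C_mul, coeff_X_pow_mul', coeff_genFun]
  split_ifs with h
  · rw [coeff_genFun, ← ENNReal.tsum_mul_left]
    refine tsum_congr fun a => ?_
    have : ℓ a + k = n ↔ ℓ a = n - k := by omega
    simp [this]
  · rw [mul_zero]
    refine ENNReal.tsum_eq_zero.2 fun a => if_neg (by omega)

/-- The value at `z` of a power series, in `[0, ∞]`. -/
def evalAt (z : ℝ≥0∞) (f : ℝ≥0∞⟦X⟧) : ℝ≥0∞ := ∑' n, coeff n f * z ^ n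

theorem evalAt_genFun {α : Type*} (z : ℝ≥0∞) (ℓ : α → ℕ) (w : α → ℝ≥0∞) :
    evalAt z (genFun ℓ w) = ∑' a, z ^ ℓ a * w a := by
  simp only [evalAt, coeff_genFun, ← ENNReal.tsum_mul_right]
  rw [ENNReal.tsum_comm]
  refine tsum_congr fun a => ?_
  rw [tsum_eq_single (ℓ a)]
  · simp [mul_comm]
  · intro n hn
    simp [hn.symm]

theorem genFun_coeff (f : ℝ≥0∞⟦X⟧) : genFun id (fun n => coeff n f) = f := by
  ext n
  rw [coeff_genFun, tsum_eq_single n]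
  · simp
  · intro m hm
    simp [hm]

theorem evalAt_mul (z : ℝ≥0∞) (f g : ℝ≥0∞⟦X⟧) :
    evalAt z (f * g) = evalAt z f * evalAt z g := by
  conv_lhs => rw [← genFun_coeff f, ← genFun_coeff g, ← genFun_prod, evalAt_genFun]
  rw [ENNReal.tsum_prod', evalAt, evalAt, ← ENNReal.tsum_mul_right]
  refine tsum_congr fun a => ?_
  rw [← ENNReal.tsum_mul_left]
  refine tsum_congr fun b => ?_
  simp only [id, pow_add]
  ring

theorem evalAt_one (z : ℝ≥0∞) : evalAt z 1 = 1 := by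
  rw [evalAt, tsum_eq_single 0]
  · simp
  · intro n hn
    simp [coeff_one, hn]

theorem evalAt_pow (z : ℝ≥0∞) (f : ℝ≥0∞⟦X⟧) (n : ℕ) : evalAt z (f ^ n) = evalAt z f ^ n := by
  induction n with
  | zero => rw [pow_zero, pow_zero, evalAt_one]
  | succ n ih => rw [pow_succ, pow_succ, evalAt_mul, ih]

section Geometric

variable {F G : ℝ≥0∞⟦X⟧}

/-- Iterating `G = 1 + F * G` leaves a remainder `F ^ K * G`, and `X ^ K` divides `F ^ K`; each
coefficient thus sees finitely many powers of `F`. -/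
theorem coeff_geometric_mul (hF : constantCoeff F = 0) (hG : G = 1 + F * G)
    (h : ℝ≥0∞⟦X⟧) (N : ℕ) :
    coeff N (G * h) = ∑' k, coeff N (F ^ k * h) := by
  have hX : ∀ k, X ^ k ∣ F ^ k := fun k => pow_dvd_pow_of_dvd (X_dvd_iff.2 hF) k
  have hz : ∀ k, N < k → ∀ g, coeff N (F ^ k * g) = 0 := fun k hk g =>
    X_pow_dvd_iff.1 ((hX k).mul_right g) N hk
  have hfin : ∀ K, G = ∑ k ∈ Finset.range K, F ^ k + F ^ K * G := by
    intro K
    induction K with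
    | zero => simp
    | succ K ih =>
      conv_lhs => rw [ih, hG]
      rw [Finset.sum_range_succ, mul_add, mul_one, pow_succ, add_assoc, mul_assoc]
  rw [hfin (N + 1), add_mul, map_add, mul_assoc, hz _ (Nat.lt_succ_self N), add_zero,
    Finset.sum_mul, map_sum, tsum_eq_sum]
  intro k hk
  exact hz k (by simpa using hk) h

theorem evalAt_geometric (hF : constantCoeff F = 0) (hG : G = 1 + F * G) (z : ℝ≥0∞) :
    evalAt z G = ∑' k, evalAt z F ^ k := by
  have h : ∀ N, coeff N G = ∑' k, coeff N (F ^ k) := by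
    intro N
    simpa using coeff_geometric_mul hF hG 1 N
  simp only [← evalAt_pow]
  simp only [evalAt, h, ← ENNReal.tsum_mul_right]
  exact ENNReal.tsum_comm

/-- This is the expansion of `-log (1 - F)`: since `X d/dX` sends `F ^ (k + 1) / (k + 1)` to `F ^ k`
times `X F'`, dividing the coefficient of `X ^ N` by `N` inverts the derivation. -/
theorem tsum_evalAt_pow_div (hF : constantCoeff F = 0) (hG : G = 1 + F * G)
    (z : ℝ≥0∞) :
    ∑' k : ℕ, evalAt z F ^ (k + 1) / ((k + 1 : ℕ) : ℝ≥0∞) =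
      ∑' N : ℕ, coeff N (G * (X * d⁄dX ℝ≥0∞ F)) / (N : ℝ≥0∞) * z ^ N := by
  simp only [← evalAt_pow]
  simp only [evalAt, div_eq_mul_inv, ← ENNReal.tsum_mul_right]
  rw [ENNReal.tsum_comm]
  refine tsum_congr fun N => ?_
  rw [coeff_geometric_mul hF hG, ← ENNReal.tsum_mul_right, ← ENNReal.tsum_mul_right]
  refine tsum_congr fun k => ?_
  rcases N with _ | N
  · have : coeff 0 (F ^ (k + 1)) = 0 := by simp [hF]
    rw [this, mul_left_comm]
    simp
  have h : coeff (N + 1) (F ^ k * (X * d⁄dX ℝ≥0∞ F)) * ((k + 1 : ℕ) : ℝ≥0∞) =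
      coeff (N + 1) (F ^ (k + 1)) * ((N + 1 : ℕ) : ℝ≥0∞) := by
    have h1 := coeff_derivative (F ^ (k + 1)) N
    rw [derivative_pow, ← Nat.cast_succ] at h1
    rw [Nat.succ_eq_add_one] at h1
    rw [← h1, mul_left_comm, coeff_succ_X_mul, Nat.add_sub_cancel, mul_assoc,
      ← map_natCast (C (R := ℝ≥0∞)) (k + 1), coeff_C_mul, mul_comm]
  have hk : ((k + 1 : ℕ) : ℝ≥0∞) ≠ 0 := by simp
  have hk' : ((k + 1 : ℕ) : ℝ≥0∞) ≠ ∞ := ENNReal.natCast_ne_top _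
  have hN : ((N + 1 : ℕ) : ℝ≥0∞) ≠ 0 := by simp
  have hN' : ((N + 1 : ℕ) : ℝ≥0∞) ≠ ∞ := ENNReal.natCast_ne_top _
  have h2 : coeff (N + 1) (F ^ (k + 1)) * ((k + 1 : ℕ) : ℝ≥0∞)⁻¹ =
      coeff (N + 1) (F ^ k * (X * d⁄dX ℝ≥0∞ F)) * ((N + 1 : ℕ) : ℝ≥0∞)⁻¹ := by
    calc _ = coeff (N + 1) (F ^ (k + 1)) * ((N + 1 : ℕ) : ℝ≥0∞) * ((N + 1 : ℕ) : ℝ≥0∞)⁻¹ *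
          ((k + 1 : ℕ) : ℝ≥0∞)⁻¹ := by
            rw [ENNReal.mul_inv_cancel_right hN hN']
      _ = _ := by
            rw [← h, mul_right_comm, ENNReal.mul_inv_cancel_right hk hk']
  rw [mul_right_comm, h2]

end Geometric

/-- For `t < 1` this is the logarithm series; for `t ≥ 1` both sides are `∞`, the left one by
comparison with the harmonic series. -/
theorem exp_tsum_pow_div (t : ℝ≥0∞) :
    EReal.exp ((∑' k : ℕ, t ^ (k + 1) / ((k + 1 : ℕ) : ℝ≥0∞) : ℝ≥0∞) : EReal) =
      ∑' k : ℕ, t ^ k := by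
  rcases lt_or_ge t 1 with ht | ht
  · lift t to ℝ≥0 using ht.ne_top
    have ht' : (t : ℝ) < 1 := by exact_mod_cast ht
    have hs := Real.hasSum_pow_div_log_of_abs_lt_one (x := (t : ℝ))
      (by rwa [abs_of_nonneg t.coe_nonneg])
    have h1 : ∑' k : ℕ, (t : ℝ≥0∞) ^ (k + 1) / ((k + 1 : ℕ) : ℝ≥0∞) =
        ENNReal.ofReal (-Real.log (1 - t)) := by
      rw [← hs.tsum_eq, ENNReal.ofReal_tsum_of_nonneg (fun n => by positivity) hs.summable]
      refine tsum_congr fun k => ?_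
      rw [ENNReal.ofReal_div_of_pos (by positivity), ENNReal.ofReal_pow t.coe_nonneg,
        ENNReal.ofReal_coe_nnreal]
      congr 1
      rw [← Nat.cast_add_one, ENNReal.ofReal_natCast]
    have h2 : 0 ≤ -Real.log (1 - t) := by
      rw [neg_nonneg]
      exact Real.log_nonpos (by linarith) (by linarith [t.coe_nonneg])
    rw [h1, EReal.coe_ennreal_ofReal, max_eq_left h2, EReal.exp_coe, Real.exp_neg,
      Real.exp_log (by linarith), ENNReal.tsum_geometric,
      ENNReal.ofReal_inv_of_pos (by linarith), ENNReal.ofReal_sub _ t.coe_nonneg]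
    simp
  · have h1 : ∑' k : ℕ, t ^ k = ∞ := by
      rw [ENNReal.tsum_geometric, tsub_eq_zero_of_le ht, ENNReal.inv_zero]
    have h2 : ∑' k : ℕ, t ^ (k + 1) / ((k + 1 : ℕ) : ℝ≥0∞) = ∞ := by
      rw [← top_le_iff]
      calc (∞ : ℝ≥0∞) = ∑' k : ℕ, ENNReal.ofReal (1 / ((k + 1 : ℕ) : ℝ)) := by
            rw [eq_comm, ← not_ne_iff]
            intro h
            have := ENNReal.summable_toReal h
            have h3 : Summable fun k : ℕ => 1 / ((k + 1 : ℕ) : ℝ) := by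
              refine this.congr fun k => ?_
              rw [ENNReal.toReal_ofReal (by positivity)]
            exact Real.not_summable_one_div_natCast
              ((summable_nat_add_iff (f := fun k : ℕ => 1 / (k : ℝ)) 1).1 h3)
        _ ≤ _ := by
            refine ENNReal.tsum_le_tsum fun k => ?_
            rw [ENNReal.ofReal_div_of_pos (by positivity), ENNReal.ofReal_natCast,
              ENNReal.ofReal_one]
            exact ENNReal.div_le_div_right (one_le_pow₀ ht) _
    rw [h1, h2]
    rfl

theorem exp_tsum_coeff_div {F G : ℝ≥0∞⟦X⟧} (hF : constantCoeff F = 0) (hG : G = 1 + F * G)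
    (z : ℝ≥0∞) :
    EReal.exp ((∑' N : ℕ, coeff N (G * (X * d⁄dX ℝ≥0∞ F)) / (N : ℝ≥0∞) * z ^ N : ℝ≥0∞) : EReal) =
      evalAt z G := by
  rw [← tsum_evalAt_pow_div hF hG, exp_tsum_pow_div, evalAt_geometric hF hG]

/-! ### Transfer to real coefficients, where subtraction and cancellation are available -/

/-- All coefficients are finite. -/
def FiniteCoeff (f : ℝ≥0∞⟦X⟧) : Prop := ∀ n, coeff n f ≠ ∞

/-- The power series with real coefficients. -/
def realSeries (f : ℝ≥0∞⟦X⟧) : ℝ⟦X⟧ := PowerSeries.mk fun n => (coeff n f).toReal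

theorem coeff_realSeries (f : ℝ≥0∞⟦X⟧) (n : ℕ) : coeff n (realSeries f) = (coeff n f).toReal :=
  coeff_mk _ _

theorem FiniteCoeff.one : FiniteCoeff 1 := fun n => by
  rw [coeff_one]; split_ifs <;> simp

theorem FiniteCoeff.monomial (c : ℝ≥0) (k : ℕ) : FiniteCoeff (C (c : ℝ≥0∞) * X ^ k) := fun n => by
  rw [coeff_C_mul, coeff_X_pow]; split_ifs <;> simp

theorem FiniteCoeff.add {f g : ℝ≥0∞⟦X⟧} (hf : FiniteCoeff f) (hg : FiniteCoeff g) :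
    FiniteCoeff (f + g) := fun n => by
  rw [map_add]; exact ENNReal.add_ne_top.2 ⟨hf n, hg n⟩

theorem FiniteCoeff.mul {f g : ℝ≥0∞⟦X⟧} (hf : FiniteCoeff f) (hg : FiniteCoeff g) :
    FiniteCoeff (f * g) := fun n => by
  rw [coeff_mul]
  exact ENNReal.sum_ne_top.2 fun p _ => ENNReal.mul_ne_top (hf _) (hg _)

theorem FiniteCoeff.sum {ι : Type*} {s : Finset ι} {f : ι → ℝ≥0∞⟦X⟧}
    (hf : ∀ i ∈ s, FiniteCoeff (f i)) : FiniteCoeff (∑ i ∈ s, f i) := fun n => by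
  rw [map_sum]
  exact ENNReal.sum_ne_top.2 fun i hi => hf i hi n

theorem FiniteCoeff.X_mul_derivative {f : ℝ≥0∞⟦X⟧} (hf : FiniteCoeff f) :
    FiniteCoeff (X * d⁄dX ℝ≥0∞ f) := by
  rintro (_ | n)
  · simp
  · rw [coeff_succ_X_mul, coeff_derivative]
    exact ENNReal.mul_ne_top (hf _) (by finiteness)

theorem realSeries_one : realSeries 1 = 1 := by
  ext n
  rw [coeff_realSeries, coeff_one, coeff_one]
  split_ifs <;> simp

theorem realSeries_monomial (c : ℝ≥0) (k : ℕ) :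
    realSeries (C (c : ℝ≥0∞) * X ^ k) = C (c : ℝ) * X ^ k := by
  ext n
  rw [coeff_realSeries, coeff_C_mul, coeff_C_mul, coeff_X_pow, coeff_X_pow]
  split_ifs <;> simp

theorem realSeries_add {f g : ℝ≥0∞⟦X⟧} (hf : FiniteCoeff f) (hg : FiniteCoeff g) :
    realSeries (f + g) = realSeries f + realSeries g := by
  ext n
  simp only [map_add, coeff_realSeries, ENNReal.toReal_add (hf n) (hg n)]

theorem realSeries_mul {f g : ℝ≥0∞⟦X⟧} (hf : FiniteCoeff f) (hg : FiniteCoeff g) :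
    realSeries (f * g) = realSeries f * realSeries g := by
  ext n
  simp only [coeff_mul, coeff_realSeries]
  rw [ENNReal.toReal_sum fun p _ => ENNReal.mul_ne_top (hf _) (hg _)]
  simp only [ENNReal.toReal_mul]

theorem realSeries_sum {ι : Type*} {s : Finset ι} {f : ι → ℝ≥0∞⟦X⟧}
    (hf : ∀ i ∈ s, FiniteCoeff (f i)) : realSeries (∑ i ∈ s, f i) = ∑ i ∈ s, realSeries (f i) := by
  ext n
  simp only [map_sum, coeff_realSeries]
  rw [ENNReal.toReal_sum fun i hi => hf i hi n]

theorem realSeries_X_mul_derivative (f : ℝ≥0∞⟦X⟧) :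
    realSeries (X * d⁄dX ℝ≥0∞ f) = X * d⁄dX ℝ (realSeries f) := by
  ext (_ | n)
  · simp [coeff_realSeries]
  · rw [coeff_realSeries, coeff_succ_X_mul, coeff_succ_X_mul, coeff_derivative, coeff_derivative,
      coeff_realSeries, ENNReal.toReal_mul]
    norm_cast

theorem realSeries_injOn {f g : ℝ≥0∞⟦X⟧} (hf : FiniteCoeff f) (hg : FiniteCoeff g)
    (h : realSeries f = realSeries g) : f = g := by
  ext n
  have := congrArg (coeff n) h
  rw [coeff_realSeries, coeff_realSeries] at this
  exact (ENNReal.toReal_eq_toReal_iff' (hf n) (hg n)).1 this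

end GeneratingFunctions

end LWW

/-! ### Decompositions of walks and the resulting series identities -/

namespace LWW

noncomputable section WalkDecompositions

open PowerSeries SimpleGraph

variable {V : Type*} {G : SimpleGraph V} {u v x : V}

/-- The walk `p` stays in the set `U`. -/
def Inside (U : Set V) (p : G.Walk u v) : Prop := ∀ y ∈ p.support, y ∈ U

theorem inside_append {w : V} {U : Set V} {p : G.Walk u v} {q : G.Walk v w} :
    Inside U (p.append q) ↔ Inside U p ∧ Inside U q := by
  simp only [Inside, Walk.mem_support_append_iff]
  exact ⟨fun h => ⟨fun y hy => h y (Or.inl hy), fun y hy => h y (Or.inr hy)⟩,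
    fun h y hy => hy.elim (h.1 y) (h.2 y)⟩

theorem inside_cons {w : V} {U : Set V} {h : G.Adj u v} {q : G.Walk v w} :
    Inside U (q.cons h) ↔ u ∈ U ∧ Inside U q := by
  simp [Inside]

theorem inside_concat {w : V} {U : Set V} {q : G.Walk u v} {h : G.Adj v w} :
    Inside U (q.concat h) ↔ Inside U q ∧ w ∈ U := by
  simp only [Inside, Walk.support_concat, List.mem_append, List.mem_singleton]
  exact ⟨fun h => ⟨fun y hy => h y (Or.inl hy), h w (Or.inr rfl)⟩,
    fun h y hy => hy.elim (h.1 y) fun e => e ▸ h.2⟩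

theorem inside_nil {U : Set V} : Inside U (Walk.nil : G.Walk u u) ↔ u ∈ U := by
  simp [Inside]

theorem inside_diff {U : Set V} {p : G.Walk u v} :
    Inside (U \ {x}) p ↔ Inside U p ∧ x ∉ p.support :=
  ⟨fun h => ⟨fun y hy => (h y hy).1, fun hx => (h x hx).2 rfl⟩,
    fun h y hy => ⟨h.1 y hy, fun e => h.2 (Set.mem_singleton_iff.1 e ▸ hy)⟩⟩

theorem list_append_cons_inj {l₁ l₂ t₁ t₂ : List V} (h₁ : x ∉ l₁) (h₂ : x ∉ l₂)
    (h : l₁ ++ x :: t₁ = l₂ ++ x :: t₂) : l₁ = l₂ ∧ t₁ = t₂ := by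
  rw [List.append_eq_append_iff] at h
  obtain ⟨m, h3, h4⟩ | ⟨m, h3, h4⟩ := h <;> cases m <;> simp_all

theorem list_append_cons_inj_right {l₁ l₂ t₁ t₂ : List V} (h₁ : x ∉ t₁) (h₂ : x ∉ t₂)
    (h : l₁ ++ x :: t₁ = l₂ ++ x :: t₂) : l₁ = l₂ ∧ t₁ = t₂ := by
  have h' := congrArg List.reverse h
  simp only [List.reverse_append, List.reverse_cons, List.append_assoc, List.singleton_append] at h'
  have h₃ : x ∉ t₁.reverse := by simpa using h₁
  have h₄ : x ∉ t₂.reverse := by simpa using h₂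
  obtain ⟨h3, h4⟩ := list_append_cons_inj h₃ h₄ h'
  exact ⟨List.reverse_injective h4, List.reverse_injective h3⟩

/-- Decomposition at the first visit. -/
theorem exists_first_visit {a y : V} (r : G.Walk a y) (hx : x ∈ r.support) (ha : a ≠ x) :
    ∃ (b : V) (q : G.Walk a b) (hb : G.Adj b x) (s : G.Walk x y),
      r = (q.concat hb).append s ∧ x ∉ q.support := by
  induction r with
  | nil => simp at hx; exact absurd hx.symm ha
  | @cons a a' y h r ih =>
    by_cases he : a' = x
    · subst he
      exact ⟨a, Walk.nil, h, r, by simp [Walk.concat], by simpa using ha.symm⟩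
    · have hx' : x ∈ r.support := by
        rcases List.mem_cons.1 (Walk.support_cons h r ▸ hx) with e | e
        · exact absurd e.symm ha
        · exact e
      obtain ⟨b, q, hb, s, rfl, hq⟩ := ih hx' he
      refine ⟨b, q.cons h, hb, s, by simp [Walk.concat_cons], ?_⟩
      simpa using ⟨ha.symm, hq⟩

/-- Decomposition at the last visit. -/
theorem exists_last_visit {a y : V} (p : G.Walk a y) (hx : x ∈ p.support) :
    ∃ (c : G.Walk a x) (r : G.Walk x y), p = c.append r ∧ x ∉ r.support.tail := by
  induction p with
  | nil =>
    simp at hx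
    subst hx
    exact ⟨Walk.nil, Walk.nil, rfl, by simp⟩
  | @cons a a' y h p ih =>
    by_cases hx' : x ∈ p.support
    · obtain ⟨c, r, rfl, hr⟩ := ih hx'
      exact ⟨c.cons h, r, by simp, hr⟩
    · have e : x = a := by
        rcases List.mem_cons.1 (Walk.support_cons h p ▸ hx) with e | e
        · exact e
        · exact absurd e hx'
      subst e
      exact ⟨Walk.nil, p.cons h, rfl, by simpa using hx'⟩

/-- The walks from a neighbour of `x` to a neighbour of `x` in `U \ {x}`. -/
structure Excursion (G : SimpleGraph V) (U : Set V) (x : V) where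
  first : V
  last : V
  adj_first : G.Adj x first
  adj_last : G.Adj last x
  inner : G.Walk first last
  inside : Inside (U \ {x}) inner

namespace Excursion

variable {U : Set V}

/-- The closed walk given by an excursion. -/
def walk (e : Excursion G U x) : G.Walk x x := (e.inner.concat e.adj_last).cons e.adj_first

theorem notMem (e : Excursion G U x) : x ∉ e.inner.support := (inside_diff.1 e.inside).2

theorem length_walk (e : Excursion G U x) : e.walk.length = e.inner.length + 2 := by
  simp [walk]

theorem support_walk (e : Excursion G U x) : e.walk.support = x :: (e.inner.support ++ [x]) := by
  simp [walk, Walk.support_concat]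

theorem inside_walk (e : Excursion G U x) (hx : x ∈ U) : Inside U e.walk :=
  inside_cons.2 ⟨hx, inside_concat.2 ⟨(inside_diff.1 e.inside).1, hx⟩⟩

theorem ext_support {e e' : Excursion G U x} (h : e.inner.support = e'.inner.support) :
    e = e' := by
  obtain ⟨a, b, ha, hb, q, hq⟩ := e
  obtain ⟨a', b', ha', hb', q', hq'⟩ := e'
  simp only at h
  have h1 : a = a' := by
    have h3 := q.head_support
    have h4 := q'.head_support
    simp only [h] at h3
    exact h3.symm.trans h4
  have h2 : b = b' := by
    have h3 := q.getLast_support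
    have h4 := q'.getLast_support
    simp only [h] at h3
    exact h3.symm.trans h4
  subst h1 h2
  obtain rfl := Walk.ext_support h
  rfl

/-- The excursion ends at the first return to `x`, and a list splits in only one way at the first
occurrence of `x`. -/
theorem append_injective {e e' : Excursion G U x} {c c' : G.Walk x v}
    (h : e.walk.append c = e'.walk.append c') : e = e' ∧ c = c' := by
  have h1 := congrArg Walk.support h
  simp only [Walk.support_append, support_walk, List.cons_append, List.cons.injEq, true_and,
    List.append_assoc, List.nil_append] at h1
  obtain ⟨h2, h3⟩ := list_append_cons_inj e.notMem e'.notMem h1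
  refine ⟨ext_support h2, Walk.ext_support ?_⟩
  rw [← c.cons_tail_support, ← c'.cons_tail_support, h3]

theorem walk_injective : Function.Injective (walk : Excursion G U x → G.Walk x x) :=
  fun e e' h => (append_injective (c := Walk.nil) (c' := Walk.nil) (by rw [h])).1

theorem exists_eq_append (p : G.Walk x x) (hp : Inside U p) (h0 : p ≠ Walk.nil) :
    ∃ (e : Excursion G U x) (c : G.Walk x x), p = e.walk.append c := by
  cases p with
  | nil => exact absurd rfl h0
  | @cons _ a _ h r =>
    obtain ⟨b, q, hb, s, rfl, hq⟩ := exists_first_visit r r.end_mem_support h.ne'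
    have hq' := (inside_concat.1 (inside_append.1 (inside_cons.1 hp).2).1).1
    exact ⟨⟨a, b, h, hb, q, inside_diff.2 ⟨hq', hq⟩⟩, s, by simp [walk]⟩

theorem exists_walk_eq {c : G.Walk x x} (hc : IsPolygon c) (hU : Inside U c) :
    ∃ e : Excursion G U x, e.inner.IsPath ∧ e.walk = c := by
  obtain ⟨e, s, rfl⟩ := exists_eq_append c hU fun h => by simpa [h] using hc.1
  have h := hc.2
  rw [Walk.support_append, support_walk, List.cons_append, List.tail_cons, List.append_assoc,
    List.nodup_append] at h
  refine ⟨e, (Walk.isPath_def _).2 h.1, ?_⟩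
  -- A nontrivial remainder would end at `x`, giving a second `x` among the non-initial vertices of
  -- the polygon.
  cases s with
  | nil => simp
  | cons hs s =>
    have h1 := h.2.1
    simp at h1

end Excursion

/-- The self-avoiding excursions. -/
abbrev SAExcursion (G : SimpleGraph V) (U : Set V) (x : V) :=
  {e : Excursion G U x // e.inner.IsPath}

theorem SAExcursion.isPolygon {U : Set V} (t : SAExcursion G U x) : IsPolygon t.1.walk :=
  isPolygon_cons_concat _ _ t.2 t.1.notMem

variable [DecidableEq V] (lam : SAPolygon G → ℝ≥0)

/-- The product of the activities of the loops removed from a walk. -/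
def loopProd (p : G.Walk u v) : ℝ≥0 := ((removedLoops p).map lam).prod

theorem loopProd_closed_append (c : G.Walk u u) (q : G.Walk u v) :
    loopProd lam (c.append q) = loopProd lam c * loopProd lam q := by
  simp [loopProd, removedLoops_closed_append]

theorem loopProd_cons {w : V} (hu : G.Adj u v) (p : G.Walk v w) (hp : u ∉ p.support) :
    loopProd lam (p.cons hu) = loopProd lam p := by
  simp [loopProd, removedLoops_cons hu p hp]

theorem loopProd_nil : loopProd lam (Walk.nil : G.Walk u u) = 1 := by
  simp [loopProd, removedLoops_of_isPath]

theorem weight_eq (z : ℝ≥0) (p : G.Walk u v) : weight lam z p = z ^ p.length * loopProd lam p := by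
  classical
  rw [weight, loopProd, loopVector, Finset.prod_multiset_map_count, Finsupp.prod]
  congr 1

/-- The generating function of the walks with the property `P`. -/
def walkGen (P : G.Walk u v → Prop) : ℝ≥0∞⟦X⟧ :=
  genFun (fun p : {p // P p} => p.1.length) fun p => (loopProd lam p.1 : ℝ≥0∞)

/-- The generating function of the closed walks at `x` in `U`. -/
def closedGen (U : Set V) (x : V) : ℝ≥0∞⟦X⟧ := walkGen lam fun p : G.Walk x x => Inside U p

/-- The generating function of the walks in `U` with loop erasure `η`. -/
def erasedGen (U : Set V) (η : G.Walk u v) : ℝ≥0∞⟦X⟧ :=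
  walkGen lam fun p => Inside U p ∧ loopErase p = η

/-- The generating function of the first-return loops at `x` in `U`. -/
def excursionGen (U : Set V) (x : V) : ℝ≥0∞⟦X⟧ :=
  genFun (fun e : Excursion G U x => e.walk.length) fun e => (loopProd lam e.walk : ℝ≥0∞)

theorem constantCoeff_excursionGen (U : Set V) (x : V) :
    constantCoeff (excursionGen lam U x) = 0 := by
  rw [← coeff_zero_eq_constantCoeff_apply, excursionGen, coeff_genFun]
  exact ENNReal.tsum_eq_zero.2 fun e => if_neg (by simp [e.length_walk])

/-- Renewal at the first return to `x`: a nontrivial closed walk is uniquely an excursion followed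
by a closed walk, and `loopProd` is multiplicative because the excursion is closed. -/
theorem closedGen_eq {U : Set V} {x : V} (hx : x ∈ U) :
    closedGen lam U x = 1 + excursionGen lam U x * closedGen lam U x := by
  conv_rhs => rw [← genFun_unit, excursionGen, closedGen, walkGen, ← genFun_prod]
  let f : Unit ⊕ (Excursion G U x × {p : G.Walk x x // Inside U p}) →
      {p : G.Walk x x // Inside U p} :=
    Sum.elim (fun _ => ⟨Walk.nil, inside_nil.2 hx⟩)
      fun t => ⟨t.1.walk.append t.2.1, inside_append.2 ⟨t.1.inside_walk hx, t.2.2⟩⟩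
  have hf : f.Bijective := by
    constructor
    · rintro (⟨⟩ | ⟨e, c⟩) (⟨⟩ | ⟨e', c'⟩) h
      · rfl
      · have := congrArg (fun p => p.1.length) h
        simp [f, e'.length_walk] at this
        omega
      · have := congrArg (fun p => p.1.length) h
        simp [f, e.length_walk] at this
      · obtain ⟨h1, h2⟩ := Excursion.append_injective (congrArg Subtype.val h)
        simp only at h1 h2
        rw [h1, Subtype.ext h2]
    · rintro ⟨p, hp⟩
      by_cases h0 : p = Walk.nil
      · subst h0
        exact ⟨Sum.inl (), rfl⟩
      · obtain ⟨e, c, rfl⟩ := Excursion.exists_eq_append p hp h0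
        exact ⟨Sum.inr (e, ⟨c, (inside_append.1 hp).2⟩), rfl⟩
  rw [closedGen, walkGen, ← genFun_of_bijective (w := fun t => (loopProd lam (f t).1 : ℝ≥0∞))
    f hf (fun _ => rfl) (fun _ => rfl), genFun_sum]
  congr 2
  · ext; simp [f, loopProd_nil]
  · ext t; simp [f]
  · ext t
    simp [f, loopProd_closed_append]

theorem erasedGen_nil (U : Set V) (u : V) :
    erasedGen lam U (Walk.nil : G.Walk u u) = closedGen lam U u := by
  simp [erasedGen, closedGen, loopErase_closed]

/-- Cut the walk at its last visit to `u`: the closed part erases to nothing, and the rest avoids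
`u` after its first step, so it keeps that step and erases to `η` beyond it. -/
theorem erasedGen_cons {w : V} {U : Set V} (hu : u ∈ U) (h : G.Adj u v) (η : G.Walk v w) :
    erasedGen lam U (η.cons h) = closedGen lam U u * (X * erasedGen lam (U \ {u}) η) := by
  have hX : X * erasedGen lam (U \ {u}) η = genFun
      (fun p : {p : G.Walk v w // Inside (U \ {u}) p ∧ loopErase p = η} => p.1.length + 1)
      fun p => (loopProd lam p.1 : ℝ≥0∞) := by
    have := genFun_shift
      (fun p : {p : G.Walk v w // Inside (U \ {u}) p ∧ loopErase p = η} => p.1.length)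
      (fun p => (loopProd lam p.1 : ℝ≥0∞)) 1 1
    simp only [one_mul, map_one, pow_one] at this
    exact this.symm
  rw [hX, closedGen, walkGen, ← genFun_prod, eq_comm]
  refine genFun_of_bijective (fun t => ⟨t.1.1.append (t.2.1.cons h), ?_, ?_⟩) ⟨?_, ?_⟩ ?_ ?_
  · exact inside_append.2 ⟨t.1.2, inside_cons.2 ⟨hu, (inside_diff.1 t.2.2.1).1⟩⟩
  · rw [loopErase_closed_append, loopErase_cons _ _ (inside_diff.1 t.2.2.1).2, t.2.2.2]
  · rintro ⟨⟨c, hc⟩, ⟨p, hp, hpη⟩⟩ ⟨⟨c', hc'⟩, ⟨p', hp', hpη'⟩⟩ e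
    have e1 := congrArg (fun p => p.1.support) e
    simp only [Walk.support_append, Walk.support_cons, List.tail_cons] at e1
    rw [← c.dropLast_support_concat, ← c'.dropLast_support_concat, List.append_assoc,
      List.append_assoc, List.singleton_append, List.singleton_append] at e1
    obtain ⟨e2, e3⟩ := list_append_cons_inj_right (inside_diff.1 hp).2 (inside_diff.1 hp').2 e1
    have e4 : c = c' := Walk.ext_support (by
      rw [← c.dropLast_support_concat, ← c'.dropLast_support_concat, e2])
    obtain rfl := Walk.ext_support e3
    subst e4
    rfl
  · rintro ⟨p, hp, hpη⟩
    obtain ⟨c, r, rfl, hr⟩ := exists_last_visit p p.start_mem_support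
    rw [loopErase_closed_append] at hpη
    cases r with
    | nil => rw [loopErase_closed] at hpη; cases hpη
    | cons h' r =>
      rw [Walk.support_cons, List.tail_cons] at hr
      rw [loopErase_cons _ _ hr] at hpη
      cases hpη
      obtain ⟨h1, h2⟩ := inside_append.1 hp
      exact ⟨⟨⟨c, h1⟩, ⟨r, inside_diff.2 ⟨(inside_cons.1 h2).2, hr⟩, rfl⟩⟩, rfl⟩
  · intro t
    simp
  · rintro ⟨⟨c, hc⟩, ⟨p, hp, hpη⟩⟩
    simp [loopProd_closed_append, loopProd_cons _ _ _ (inside_diff.1 hp).2]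

/-- Excursions are sorted by the loop erasure of their inner part, which determines the last removed
polygon and hence the extra activity; `X ^ 2` accounts for the two steps at `x`. -/
theorem excursionGen_eq (U : Set V) (x : V) [Fintype (SAExcursion G U x)] :
    excursionGen lam U x = ∑ t : SAExcursion G U x,
      C (lam t.isPolygon.toSAPolygon : ℝ≥0∞) * X ^ 2 * erasedGen lam (U \ {x}) t.1.inner := by
  simp only [erasedGen, walkGen, ← genFun_shift]
  rw [← genFun_sigma (ι := SAExcursion G U x)
    (α := fun t => {p // Inside (U \ {x}) p ∧ loopErase p = t.1.inner})
    (fun s => s.2.1.length + 2)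
    (fun s => (lam s.1.isPolygon.toSAPolygon : ℝ≥0∞) * (loopProd lam s.2.1 : ℝ≥0∞)), eq_comm]
  refine genFun_of_bijective
    (fun s => ⟨s.1.1.first, s.1.1.last, s.1.1.adj_first, s.1.1.adj_last, s.2.1, s.2.2.1⟩)
    ⟨?_, ?_⟩ ?_ ?_
  · rintro ⟨⟨⟨a, b, ha, hb, η, hη⟩, hp⟩, ⟨p, h1, h2⟩⟩ ⟨⟨⟨a', b', ha', hb', η', hη'⟩, hp'⟩,
      ⟨p', h1', h2'⟩⟩ e
    simp only at p p' h2 h2'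
    subst h2 h2'
    cases e
    rfl
  · rintro ⟨a, b, ha, hb, p, hp⟩
    exact ⟨⟨⟨⟨a, b, ha, hb, loopErase p, fun y hy => hp y (support_loopErase_subset p hy)⟩,
      isPath_loopErase p⟩, ⟨p, hp, rfl⟩⟩, rfl⟩
  · rintro ⟨t, p⟩
    simp [Excursion.length_walk]
  · rintro ⟨⟨⟨a, b, ha, hb, η, hη⟩, hp⟩, ⟨p, h1, h2⟩⟩
    simp only at p h2
    subst h2
    simp only [Excursion.walk, loopProd]
    rw [removedLoops_cons_concat _ _ _ (inside_diff.1 h1).2]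
    simp [mul_comm]

end WalkDecompositions

end LWW

/-! ### Finite vertex sets: rotations of polygons and the polygon determinant -/

namespace LWW

noncomputable section FiniteSets

open PowerSeries SimpleGraph

variable {V : Type*} {G : SimpleGraph V} {u v x : V}

theorem finite_lists_of_length_le (S : Finset V) (n : ℕ) :
    {l : List V | l.length ≤ n ∧ ∀ y ∈ l, y ∈ S}.Finite := by
  refine ((List.finite_length_le S n).image (List.map Subtype.val)).subset ?_
  rintro l ⟨h1, h2⟩
  refine ⟨l.attach.map fun y => ⟨y.1, h2 y.1 y.2⟩, ?_, ?_⟩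
  · simpa using h1
  · simp [List.map_map, Function.comp_def]

theorem finite_walks_of_length_le (S : Finset V) (n : ℕ) :
    {p : G.Walk u v | p.length ≤ n ∧ Inside (S : Set V) p}.Finite := by
  refine Set.Finite.of_finite_image ((finite_lists_of_length_le S (n + 1)).subset ?_)
    (f := Walk.support) fun p _ q _ h => Walk.ext_support h
  rintro _ ⟨p, ⟨h1, h2⟩, rfl⟩
  exact ⟨by rw [Walk.length_support]; omega, h2⟩

theorem IsPolygon.length_eq [DecidableEq V] {c : G.Walk x x} (hc : IsPolygon c) :
    c.support.toFinset.card = c.length := by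
  have h : c.support.toFinset = c.support.tail.toFinset := by
    ext y
    rw [List.mem_toFinset, List.mem_toFinset]
    refine ⟨fun hy => ?_, List.mem_of_mem_tail⟩
    rw [← c.cons_tail_support, List.mem_cons] at hy
    rcases hy with rfl | hy
    · exact c.end_mem_tail_support (by rw [← Walk.length_eq_zero_iff]; exact hc.1.ne')
    · exact hy
  rw [h, List.toFinset_card_of_nodup hc.2, List.length_tail, Walk.length_support]
  rfl

/-- Distinct rotations of a duplicate-free list have distinct last entries. For a polygon,
`support.tail` ends with the base vertex, so the base vertex fixes the rotation. -/
theorem eq_of_isRotated {l l' : List V} (h : l ~r l') (hl : l.Nodup) (h0 : l ≠ []) (h0' : l' ≠ [])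
    (e : l.getLast h0 = l'.getLast h0') : l = l' := by
  obtain ⟨n, rfl⟩ := h
  rw [List.getLast_eq_getElem, List.getLast_eq_getElem, List.getElem_rotate] at e
  have h1 := (List.Nodup.getElem_inj_iff hl).1 e
  have h2 : 0 < l.length := List.length_pos_of_ne_nil h0
  rw [List.length_rotate] at h1
  have h3 : n % l.length = 0 := by
    have h4 : (l.length - 1) % l.length = (l.length - 1 + n) % l.length := by
      rw [← h1, Nat.mod_eq_of_lt (by omega)]
    have h5 : l.length - 1 + 0 ≡ l.length - 1 + n [MOD l.length] := h4
    exact (Nat.ModEq.add_left_cancel' _ h5).symm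
  rw [← List.rotate_mod, h3, List.rotate_zero]

theorem IsPolygon.eq_of_isRotated {c c' : G.Walk x x} (hc : IsPolygon c)
    (h : c.support.tail ~r c'.support.tail) : c = c' := by
  have hc' : 0 < c'.length := by
    have h1 := h.perm.length_eq
    have h2 := hc.1
    simp only [List.length_tail, Walk.length_support] at h1
    omega
  have h0 : c.support.tail ≠ [] := by
    rw [← List.length_pos_iff]; simpa using hc.1
  have h0' : c'.support.tail ≠ [] := by
    rw [← List.length_pos_iff]; simpa using hc'
  apply Walk.ext_support
  rw [← c.cons_tail_support, ← c'.cons_tail_support,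
    LWW.eq_of_isRotated h hc.2 h0 h0' (by simp [List.getLast_tail])]

variable [DecidableEq V]

/-- The closed walks at `x` that are polygons with vertex set `A`. -/
abbrev PolygonOn (G : SimpleGraph V) (x : V) (A : Finset V) :=
  {c : G.Walk x x // IsPolygon c ∧ c.support.toFinset = A}

instance (x : V) (A : Finset V) : Finite (PolygonOn G x A) := by
  refine ((finite_walks_of_length_le A A.card).subset ?_ :
    {c : G.Walk x x | IsPolygon c ∧ c.support.toFinset = A}.Finite)
  rintro c ⟨h1, rfl⟩
  exact ⟨h1.length_eq.ge, fun y hy => by simpa using hy⟩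

instance (x : V) (A : Finset V) : Fintype (PolygonOn G x A) := Fintype.ofFinite _

instance (S : Finset V) (x : V) : Finite (SAExcursion G (S : Set V) x) := by
  have h := ((finite_lists_of_length_le S S.card)).to_subtype
  refine Finite.of_injective (β := {l : List V | l.length ≤ S.card ∧ ∀ y ∈ l, y ∈ S})
    (fun t => ⟨t.1.inner.support, ?_, fun y hy => (t.1.inside y hy).1⟩) ?_
  · rw [← List.toFinset_card_of_nodup t.2.support_nodup]
    exact Finset.card_le_card fun y hy => (t.1.inside y (List.mem_toFinset.1 hy)).1
  · intro t t' h
    exact Subtype.ext (Excursion.ext_support (congrArg Subtype.val h))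

instance (S : Finset V) (x : V) : Fintype (SAExcursion G (S : Set V) x) := Fintype.ofFinite _

section Rotation

theorem IsPolygon.rotate {c : G.Walk x x} (hc : IsPolygon c) {y : V} (hy : y ∈ c.support) :
    IsPolygon (c.rotate y hy) :=
  ⟨by simpa using hc.1, (c.support_rotate y hy).nodup_iff.2 hc.2⟩

/-- The total activity of the polygons with initial vertex `x` and vertex set `A`. -/
def polygonSum (lam : SAPolygon G → ℝ≥0) (x : V) (A : Finset V) : ℝ≥0 :=
  ∑ c : PolygonOn G x A, lam c.2.1.toSAPolygon

/-- Rotating the base from `x` to `y` is a bijection of oriented polygons on `A`. This is where the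
cyclic invariance of the activities enters the argument. -/
theorem polygonSum_eq {lam : SAPolygon G → ℝ≥0} (hlam : RotationInvariant lam) {y : V}
    {A : Finset V} (hx : x ∈ A) (hy : y ∈ A) : polygonSum lam x A = polygonSum lam y A := by
  have hmem : ∀ {a b : V}, b ∈ A → ∀ c : PolygonOn G a A, b ∈ c.1.support := fun hb c => by
    rwa [← List.mem_toFinset, c.2.2]
  let rot : ∀ (a b : V), b ∈ A → PolygonOn G a A → PolygonOn G b A := fun a b hb c =>
    ⟨c.1.rotate b (hmem hb c), c.2.1.rotate _, by
      refine Eq.trans ?_ c.2.2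
      ext
      simp only [List.mem_toFinset, Walk.mem_support_rotate_iff]⟩
  have hrot : ∀ a b (ha : a ∈ A) (hb : b ∈ A), Function.LeftInverse (rot b a ha) (rot a b hb) := by
    intro a b ha hb c
    refine Subtype.ext (IsPolygon.eq_of_isRotated (c.2.1.rotate _ |>.rotate _) ?_)
    exact (Walk.support_rotate _ _ _).trans (Walk.support_rotate _ _ _)
  refine Fintype.sum_equiv ⟨rot x y hy, rot y x hx, hrot x y hx hy, hrot y x hy hx⟩ _ _ ?_
  intro c
  exact (hlam c.2.1.toSAPolygon (c.2.1.rotate (hmem hy c)).toSAPolygon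
    ⟨hmem hy c, rfl⟩).symm

end Rotation

variable (lam : SAPolygon G → ℝ≥0)

/-- The generating function of the oriented polygons with vertex set `A`. -/
def polygonSeries (A : Finset V) : ℝ⟦X⟧ :=
  -- By `polygonSeries_eq` the chosen vertex is immaterial for rotation-invariant activities.
  if h : A.Nonempty then C (polygonSum lam h.choose A : ℝ) * X ^ A.card else 0

theorem polygonSeries_eq {lam : SAPolygon G → ℝ≥0} (hlam : RotationInvariant lam)
    {A : Finset V} (hx : x ∈ A) :
    polygonSeries lam A = C (polygonSum lam x A : ℝ) * X ^ A.card := by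
  have h : A.Nonempty := ⟨x, hx⟩
  rw [polygonSeries, dif_pos h, polygonSum_eq hlam h.choose_spec hx]

/-- The derivation `X d/dX`. -/
def eulerDerivation : Derivation ℝ ℝ⟦X⟧ ℝ⟦X⟧ := (X : ℝ⟦X⟧) • d⁄dX ℝ

theorem eulerDerivation_apply (f : ℝ⟦X⟧) : eulerDerivation f = X * d⁄dX ℝ f := rfl

theorem coeff_eulerDerivation (f : ℝ⟦X⟧) (n : ℕ) :
    coeff n (eulerDerivation f) = n * coeff n f := by
  rw [eulerDerivation_apply]
  rcases n with _ | n
  · simp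
  · rw [coeff_succ_X_mul, coeff_derivative, mul_comm, Nat.cast_add_one]

theorem eulerDerivation_polygonSeries (A : Finset V) :
    eulerDerivation (polygonSeries lam A) = A.card * polygonSeries lam A := by
  rw [polygonSeries]
  split_ifs with h
  · ext n
    rw [coeff_eulerDerivation, ← map_natCast (C (R := ℝ)) A.card, coeff_C_mul, coeff_C_mul,
      coeff_C_mul, coeff_X_pow]
    split_ifs with h1
    · rw [h1]
    · simp
  · simp

section FiniteCoeff

theorem finiteCoeff_walkGen (S : Finset V) {P : G.Walk u v → Prop}
    (hP : ∀ p, P p → Inside (S : Set V) p) : FiniteCoeff (walkGen lam P) := by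
  intro n
  rw [walkGen, coeff_genFun]
  have hfin : {p : {p // P p} | p.1.length = n}.Finite := by
    refine Set.Finite.of_finite_image ((finite_walks_of_length_le S n).subset ?_)
      (f := Subtype.val) Subtype.val_injective.injOn
    rintro _ ⟨p, hp, rfl⟩
    exact ⟨le_of_eq hp, hP p.1 p.2⟩
  rw [tsum_eq_sum (s := hfin.toFinset)]
  · exact ENNReal.sum_ne_top.2 fun p _ => by split_ifs <;> simp
  · intro p hp
    rw [if_neg]
    simpa using hp

theorem finiteCoeff_closedGen (S : Finset V) (x : V) : FiniteCoeff (closedGen lam (S : Set V) x) :=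
  finiteCoeff_walkGen lam S fun _ h => h

theorem finiteCoeff_erasedGen (S : Finset V) (η : G.Walk u v) :
    FiniteCoeff (erasedGen lam (S : Set V) η) :=
  finiteCoeff_walkGen lam S fun _ h => h.1

theorem finiteCoeff_excursionGen (S : Finset V) (x : V) :
    FiniteCoeff (excursionGen lam (S : Set V) x) := by
  rw [excursionGen_eq, ← Finset.coe_erase]
  exact FiniteCoeff.sum fun t _ => (FiniteCoeff.monomial _ _).mul (finiteCoeff_erasedGen lam _ _)

end FiniteCoeff

/-- The alternating sum over families of disjoint oriented polygons in `S`. -/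
abbrev polygonDet (S : Finset V) : ℝ⟦X⟧ := disjointSum (polygonSeries lam) S

theorem realSeries_closedGen_mul {S : Finset V} (hx : x ∈ S) :
    realSeries (closedGen lam (S : Set V) x) *
      (1 - realSeries (excursionGen lam (S : Set V) x)) = 1 := by
  have h := congrArg realSeries (closedGen_eq lam (U := (S : Set V)) (Finset.mem_coe.2 hx))
  rw [realSeries_add FiniteCoeff.one
    ((finiteCoeff_excursionGen lam S x).mul (finiteCoeff_closedGen lam S x)),
    realSeries_mul (finiteCoeff_excursionGen lam S x) (finiteCoeff_closedGen lam S x),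
    realSeries_one] at h
  linear_combination h

/-- Each vertex peeled off `η` contributes `X` (except the last) and a ratio `polygonDet (T.erase x)
/ polygonDet T`; the product telescopes. The hypothesis `hS` is supplied later by an induction on
finite sets. -/
theorem realSeries_erasedGen_mul {S : Finset V}
    (hS : ∀ T ⊆ S, ∀ x ∈ T,
      realSeries (closedGen lam (T : Set V) x) * polygonDet lam T = polygonDet lam (T.erase x))
    (η : G.Walk u v) (hη : η.IsPath) (hin : Inside (S : Set V) η) :
    realSeries (erasedGen lam (S : Set V) η) * polygonDet lam S =
      X ^ η.length * polygonDet lam (S \ η.support.toFinset) := by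
  induction η generalizing S with
  | @nil u =>
    rw [erasedGen_nil, hS S subset_rfl _ (hin _ (by simp))]
    simp [Finset.sdiff_singleton_eq_erase]
  | @cons u v w h η ih =>
    obtain ⟨hu, hin'⟩ := inside_cons.1 hin
    obtain ⟨hp, hu'⟩ := (Walk.cons_isPath_iff h η).1 hη
    have hin'' : Inside ((S.erase u : Finset V) : Set V) η := by
      rw [Finset.coe_erase]
      exact inside_diff.2 ⟨hin', hu'⟩
    have ih' := ih (S := S.erase u)
      (fun T hT => hS T (hT.trans (Finset.erase_subset _ _))) hp hin''
    have hX : FiniteCoeff (X : ℝ≥0∞⟦X⟧) := by simpa using FiniteCoeff.monomial 1 1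
    have hX' : realSeries (X : ℝ≥0∞⟦X⟧) = X := by simpa using realSeries_monomial 1 1
    have hE := finiteCoeff_erasedGen lam (S.erase u) η
    rw [erasedGen_cons lam hu, ← Finset.coe_erase,
      realSeries_mul (finiteCoeff_closedGen lam S u) (hX.mul hE), realSeries_mul hX hE, hX']
    have hset : S \ (η.cons h).support.toFinset = S.erase u \ η.support.toFinset := by
      ext y
      simp
      tauto
    rw [hset, Walk.length_cons, pow_succ]
    linear_combination X * realSeries (erasedGen lam ((S.erase u : Finset V) : Set V) η) *
      hS S subset_rfl u hu + X * ih'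

/-- Closing up a self-avoiding excursion gives each polygon based at `x` in `S` exactly once; the
sum is then sorted by vertex set. -/
theorem sum_saExcursion {M : Type*} [AddCommMonoid M] {S : Finset V} (hx : x ∈ S)
    (f : SAPolygon G → Finset V → M) :
    ∑ t : SAExcursion G (S : Set V) x, f t.isPolygon.toSAPolygon t.1.walk.support.toFinset =
      ∑ A ∈ S.powerset with x ∈ A, ∑ c : PolygonOn G x A, f c.2.1.toSAPolygon A := by
  rw [← Finset.sum_coe_sort (S.powerset.filter (x ∈ ·))
    fun A => ∑ c : PolygonOn G x A, f c.2.1.toSAPolygon A, ← Fintype.sum_sigma']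
  have hA : ∀ t : SAExcursion G (S : Set V) x,
      t.1.walk.support.toFinset ∈ S.powerset.filter (x ∈ ·) := by
    intro t
    refine Finset.mem_filter.2 ⟨Finset.mem_powerset.2 fun y hy => ?_, by simp⟩
    exact t.1.inside_walk hx y (List.mem_toFinset.1 hy)
  refine Fintype.sum_bijective
    (fun t => ⟨⟨t.1.walk.support.toFinset, hA t⟩, ⟨t.1.walk, t.isPolygon, rfl⟩⟩) ⟨?_, ?_⟩ _ _ ?_
  · intro t t' h
    have h' := congrArg
      (fun s : Σ A : {A // A ∈ S.powerset.filter (x ∈ ·)}, PolygonOn G x A.1 => s.2.1) h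
    exact Subtype.ext (Excursion.walk_injective h')
  · rintro ⟨⟨A, hA⟩, ⟨c, hc, hcA⟩⟩
    simp only at hcA
    subst hcA
    have hin : Inside (S : Set V) c := fun y hy =>
      Finset.mem_powerset.1 (Finset.mem_filter.1 hA).1 (List.mem_toFinset.2 hy)
    obtain ⟨e, he, rfl⟩ := Excursion.exists_walk_eq hc hin
    exact ⟨⟨e, he⟩, rfl⟩
  · intro t
    rfl

/-- An excursion with erased inner part `η` contributes its activity times `X ^ (|η| + 2)` and the
determinant of what `x` and `η` leave of `S`. The exponent is the number of vertices of the polygon,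
so the terms group by its vertex set `A`. -/
theorem realSeries_excursionGen_mul {lam : SAPolygon G → ℝ≥0}
    (hlam : RotationInvariant lam) {S : Finset V} (hx : x ∈ S)
    (hS : ∀ T ⊆ S.erase x, ∀ y ∈ T,
      realSeries (closedGen lam (T : Set V) y) * polygonDet lam T = polygonDet lam (T.erase y)) :
    realSeries (excursionGen lam (S : Set V) x) * polygonDet lam (S.erase x) =
      ∑ A ∈ S.powerset with x ∈ A, polygonSeries lam A * polygonDet lam (S \ A) := by
  have hfin : ∀ t ∈ (Finset.univ : Finset (SAExcursion G (S : Set V) x)),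
      FiniteCoeff (C (lam t.isPolygon.toSAPolygon : ℝ≥0∞) * X ^ 2 *
        erasedGen lam ((S.erase x : Finset V) : Set V) t.1.inner) := fun t _ =>
    (FiniteCoeff.monomial _ _).mul (finiteCoeff_erasedGen lam _ _)
  rw [excursionGen_eq, ← Finset.coe_erase, realSeries_sum hfin, Finset.sum_mul]
  have h1 : ∀ A ∈ S.powerset.filter (x ∈ ·), polygonSeries lam A * polygonDet lam (S \ A) =
      ∑ c : PolygonOn G x A,
        C (lam c.2.1.toSAPolygon : ℝ) * X ^ A.card * polygonDet lam (S \ A) := by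
    intro A hA
    rw [polygonSeries_eq hlam (Finset.mem_filter.1 hA).2, polygonSum, NNReal.coe_sum, map_sum,
      Finset.sum_mul, Finset.sum_mul]
  rw [Finset.sum_congr rfl h1, ← sum_saExcursion hx fun γ A =>
    C (lam γ : ℝ) * X ^ A.card * polygonDet lam (S \ A)]
  refine Finset.sum_congr rfl fun t _ => ?_
  have hin : Inside ((S.erase x : Finset V) : Set V) t.1.inner := by
    rw [Finset.coe_erase]
    exact t.1.inside
  have hset : S \ t.1.walk.support.toFinset = S.erase x \ t.1.inner.support.toFinset := by
    ext y
    simp [Excursion.support_walk]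
    tauto
  rw [realSeries_mul (FiniteCoeff.monomial _ _) (finiteCoeff_erasedGen lam _ _),
    realSeries_monomial, mul_assoc, realSeries_erasedGen_mul lam hS _ t.2 hin, hset,
    t.isPolygon.length_eq, t.1.length_walk, pow_add]
  ring

/-- The recursion `disjointSum_eq` becomes `D_S = D_{S \ x} (1 - F)`, while `Γ (1 - F) = 1`. The
formula for `F` needs the claim only for subsets of `S \ x`. -/
theorem realSeries_closedGen_mul_polygonDet {lam : SAPolygon G → ℝ≥0}
    (hlam : RotationInvariant lam) (S : Finset V) {x : V} (hx : x ∈ S) :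
    realSeries (closedGen lam (S : Set V) x) * polygonDet lam S = polygonDet lam (S.erase x) := by
  induction S using Finset.strongInduction generalizing x with
  | H S ih =>
    have hF : realSeries (excursionGen lam (S : Set V) x) * polygonDet lam (S.erase x) =
        ∑ A ∈ S.powerset with x ∈ A, polygonSeries lam A * polygonDet lam (S \ A) :=
      realSeries_excursionGen_mul hlam hx fun T hT y hy =>
        ih T (hT.trans_lt (Finset.erase_ssubset hx)) hy
    have hD := disjointSum_eq (polygonSeries lam) (S := S) (x := x)
    rw [← hF] at hD
    have hG := realSeries_closedGen_mul lam hx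
    rw [polygonDet, hD]
    linear_combination polygonDet lam (S.erase x) * hG

theorem polygonDet_ne_zero {lam : SAPolygon G → ℝ≥0}
    (hlam : RotationInvariant lam) (S : Finset V) : polygonDet lam S ≠ 0 := by
  induction S using Finset.induction_on with
  | empty => rw [polygonDet, disjointSum_empty]; exact one_ne_zero
  | insert x S hx ih =>
    intro h
    have := realSeries_closedGen_mul_polygonDet hlam (insert x S) (Finset.mem_insert_self x S)
    rw [h, mul_zero, Finset.erase_insert hx] at this
    exact ih this.symm

/-- The logarithmic derivative of `1 / (1 - F)` for the first-return series `F` at `x` counts the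
closed walks through `x`. -/
theorem sum_closedGen_eq {lam : SAPolygon G → ℝ≥0} (hlam : RotationInvariant lam) (S : Finset V)
    {x : V} (hx : x ∈ S) :
    ∑ y ∈ S, closedGen lam (S : Set V) y =
      closedGen lam (S : Set V) x * (X * d⁄dX ℝ≥0∞ (excursionGen lam (S : Set V) x)) + 1 +
        ∑ y ∈ S.erase x, closedGen lam ((S.erase x : Finset V) : Set V) y := by
  have f1 := FiniteCoeff.sum (s := S) fun y _ => finiteCoeff_closedGen lam S y
  have f2 := FiniteCoeff.sum (s := S.erase x) fun y _ => finiteCoeff_closedGen lam (S.erase x) y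
  have f3 := (finiteCoeff_excursionGen lam S x).X_mul_derivative
  have f4 := finiteCoeff_closedGen lam S x
  refine realSeries_injOn f1 (((f4.mul f3).add FiniteCoeff.one).add f2) ?_
  rw [realSeries_add ((f4.mul f3).add FiniteCoeff.one) f2, realSeries_add (f4.mul f3)
    FiniteCoeff.one, realSeries_mul f4 f3, realSeries_one, realSeries_X_mul_derivative,
    ← eulerDerivation_apply, realSeries_sum fun y _ => finiteCoeff_closedGen lam S y,
    realSeries_sum fun y _ => finiteCoeff_closedGen lam (S.erase x) y]
  -- In `θ D_T = ∑ (D_T - D_{T \ y})` each `D_{T \ y}` equals `Γ_T(y) D_T`.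
  have hθ : ∀ T : Finset V, eulerDerivation (polygonDet lam T) = polygonDet lam T *
      (T.card - ∑ y ∈ T, realSeries (closedGen lam (T : Set V) y)) := by
    intro T
    rw [polygonDet, derivation_disjointSum _ _ (eulerDerivation_polygonSeries lam),
      mul_sub, Finset.mul_sum, Finset.sum_sub_distrib, Finset.sum_const, nsmul_eq_mul, mul_comm]
    congr 1
    refine Finset.sum_congr rfl fun y hy => ?_
    rw [← polygonDet, ← realSeries_closedGen_mul_polygonDet hlam T hy, mul_comm]
  have hG := realSeries_closedGen_mul lam hx
  have hGD := realSeries_closedGen_mul_polygonDet hlam S hx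
  have h1 := hθ S
  have h2 := hθ (S.erase x)
  have hcard : ((S.erase x).card : ℝ⟦X⟧) = S.card - 1 := by
    rw [Finset.card_erase_of_mem hx, Nat.cast_sub (Finset.card_pos.2 ⟨x, hx⟩), Nat.cast_one]
  rw [hcard] at h2
  set Γ := realSeries (closedGen lam (S : Set V) x)
  set F := realSeries (excursionGen lam (S : Set V) x)
  set D := polygonDet lam S
  set D' := polygonDet lam (S.erase x)
  have hD : D = D' * (1 - F) := by
    linear_combination (-D) * hG + (1 - F) * hGD
  have h3 : eulerDerivation D = eulerDerivation D' * (1 - F) - D' * eulerDerivation F := by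
    rw [hD, Derivation.leibniz, map_sub, Derivation.map_one_eq_zero, smul_eq_mul, smul_eq_mul]
    ring
  -- Multiply `h3` by `Γ`, use `Γ D = D'` and `Γ (1 - F) = 1`, then cancel `D'`. The `1` in the
  -- claim is the drop in cardinality from `S` to `S.erase x`.
  refine mul_left_cancel₀ (polygonDet_ne_zero hlam (S.erase x)) ?_
  rw [h1, h2] at h3
  linear_combination (-Γ) * h3 +
    (S.card - ∑ y ∈ S, realSeries (closedGen lam (S : Set V) y)) * hGD -
    D' * (S.card - 1 - ∑ y ∈ S.erase x,
      realSeries (closedGen lam ((S.erase x : Finset V) : Set V) y)) * hG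

end FiniteSets

end LWW

/-! ### The loop measure, exhaustion by finite sets, and the exponential formula -/

namespace LWW

noncomputable section LoopMeasure

open PowerSeries SimpleGraph Filter Topology

variable {V : Type*} {G : SimpleGraph V} {u v x : V}

theorem range_inter_compl_eq_empty {U : Set V} {p : G.Walk u v} :
    range p ∩ Uᶜ = ∅ ↔ Inside U p := by
  rw [← Set.sdiff_eq, Set.sdiff_eq_empty]
  rfl

variable [DecidableEq V] (lam : SAPolygon G → ℝ≥0)

open scoped Classical in
theorem coeff_walkGen (P : G.Walk u v → Prop) (n : ℕ) :
    coeff n (walkGen lam P) =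
      ∑' p : G.Walk u v, if P p ∧ p.length = n then (loopProd lam p : ℝ≥0∞) else 0 := by
  rw [walkGen, coeff_genFun]
  refine (tsum_subtype {p | P p}
    fun p : G.Walk u v => if p.length = n then (loopProd lam p : ℝ≥0∞) else 0).trans ?_
  refine tsum_congr fun p => ?_
  rw [Set.indicator_apply]
  simp only [Set.mem_ofPred_eq, ite_and]

/-- The generating function of the closed walks at `y` in `U` through `x`. -/
def throughGen (U : Set V) (x y : V) : ℝ≥0∞⟦X⟧ :=
  walkGen lam fun p : G.Walk y y => Inside U p ∧ x ∈ p.support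

theorem closedGen_eq_through_add (U : Set V) (x y : V) :
    closedGen lam U y = throughGen lam U x y + closedGen lam (U \ {x}) y := by
  classical
  ext n
  rw [map_add, closedGen, throughGen, closedGen, coeff_walkGen, coeff_walkGen, coeff_walkGen,
    ← ENNReal.tsum_add]
  refine tsum_congr fun p => ?_
  simp only [inside_diff]
  by_cases h1 : Inside U p <;> by_cases h2 : x ∈ p.support <;> simp [h1, h2]

theorem closedGen_of_notMem {U : Set V} (hx : x ∉ U) : closedGen lam U x = 0 := by
  classical
  ext n
  rw [closedGen, coeff_walkGen, map_zero, ENNReal.tsum_eq_zero]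
  exact fun p => if_neg fun h => hx (h.1 x p.start_mem_support)

/-- The closed walks avoiding `x` are those in `S.erase x`; their coefficients are finite and
cancel. The summand `1` is the trivial walk at `x`. -/
theorem sum_throughGen_eq {lam : SAPolygon G → ℝ≥0} (hlam : RotationInvariant lam) (S : Finset V)
    {x : V} (hx : x ∈ S) :
    ∑ y ∈ S, throughGen lam (S : Set V) x y = closedGen lam (S : Set V) x *
      (X * d⁄dX ℝ≥0∞ (excursionGen lam (S : Set V) x)) + 1 := by
  have h := sum_closedGen_eq hlam S hx
  have h1 : ∑ y ∈ S, closedGen lam (S : Set V) y = ∑ y ∈ S, throughGen lam (S : Set V) x y +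
      ∑ y ∈ S.erase x, closedGen lam ((S.erase x : Finset V) : Set V) y := by
    have h0 : closedGen lam ((S.erase x : Finset V) : Set V) x = 0 :=
      closedGen_of_notMem lam (by simp)
    rw [Finset.sum_erase S h0, ← Finset.sum_add_distrib, Finset.coe_erase]
    exact Finset.sum_congr rfl fun y _ => closedGen_eq_through_add lam _ _ _
  rw [h1] at h
  have f := FiniteCoeff.sum (s := S.erase x) fun y _ => finiteCoeff_closedGen lam (S.erase x) y
  ext n
  have h2 := congrArg (coeff n) h
  rw [map_add, map_add _ (_ + 1)] at h2
  exact (ENNReal.add_left_inj (f n)).1 h2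

open scoped Classical in
theorem loopMeasureAvoiding_compl (z : ℝ≥0) (A U : Set V) :
    loopMeasureAvoiding lam z A Uᶜ = ∑' t : Σ y : V, G.Walk y y,
      if 1 ≤ t.2.length ∧ (range t.2 ∩ A).Nonempty ∧ Inside U t.2 then
        (weight lam z t.2 : ℝ≥0∞) / (t.2.length : ℝ≥0∞) else 0 := by
  rw [ENNReal.tsum_sigma', loopMeasureAvoiding]
  refine tsum_congr fun y => tsum_congr fun p => ?_
  simp only [range_inter_compl_eq_empty]

theorem loopMeasureAvoiding_finset {lam : SAPolygon G → ℝ≥0} (hlam : RotationInvariant lam)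
    (z : ℝ≥0) (S : Finset V) {x : V} (hx : x ∈ S) :
    loopMeasureAvoiding lam z {x} (S : Set V)ᶜ =
      ∑' N : ℕ, coeff N (closedGen lam (S : Set V) x *
        (X * d⁄dX ℝ≥0∞ (excursionGen lam (S : Set V) x))) / (N : ℝ≥0∞) * (z : ℝ≥0∞) ^ N := by
  classical
  have h1 : ∀ N : ℕ, coeff N (closedGen lam (S : Set V) x *
      (X * d⁄dX ℝ≥0∞ (excursionGen lam (S : Set V) x))) / (N : ℝ≥0∞) * (z : ℝ≥0∞) ^ N =
      ∑' t : Σ y : V, G.Walk y y, if t.2.length = N then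
        if 1 ≤ t.2.length ∧ (range t.2 ∩ {x}).Nonempty ∧ Inside (S : Set V) t.2 then
          (weight lam z t.2 : ℝ≥0∞) / (t.2.length : ℝ≥0∞) else 0 else 0 := by
    rintro (_ | N)
    -- Walks without steps are excluded from the measure, and on the series side the factor `X`
    -- kills the constant term.
    · rw [mul_left_comm, coeff_zero_X_mul, ENNReal.zero_div, zero_mul, eq_comm,
        ENNReal.tsum_eq_zero]
      intro t
      split_ifs <;> first | rfl | omega
    have h2 := congrArg (coeff (N + 1)) (sum_throughGen_eq hlam S hx)
    rw [map_add, coeff_one, if_neg (Nat.succ_ne_zero N), add_zero, map_sum] at h2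
    rw [← h2, ENNReal.tsum_sigma', tsum_eq_sum (s := S), div_eq_mul_inv, Finset.sum_mul,
      Finset.sum_mul]
    · refine Finset.sum_congr rfl fun y _ => ?_
      rw [throughGen, coeff_walkGen, ← ENNReal.tsum_mul_right, ← ENNReal.tsum_mul_right]
      refine tsum_congr fun p => ?_
      by_cases hN : p.length = N + 1
      · have hr : (range p ∩ {x}).Nonempty ↔ x ∈ p.support := by
          rw [Set.inter_singleton_nonempty]; rfl
        simp only [hN, hr, and_true, if_true, weight_eq, Nat.le_add_left, true_and,
          and_comm (a := x ∈ p.support)]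
        split_ifs
        · push_cast
          rw [div_eq_mul_inv]
          ring
        · simp
      · simp [hN]
    · intro y hy
      refine ENNReal.tsum_eq_zero.2 fun p => ?_
      have h3 : ¬ Inside (S : Set V) p := fun h => hy (h y p.start_mem_support)
      simp [h3]
  simp only [h1]
  rw [ENNReal.tsum_comm, loopMeasureAvoiding_compl]
  refine tsum_congr fun t => ?_
  rw [tsum_eq_single t.2.length]
  · simp
  · intro N hN
    rw [if_neg hN.symm]

theorem exp_loopMeasureAvoiding_finset {lam : SAPolygon G → ℝ≥0} (hlam : RotationInvariant lam)
    (z : ℝ≥0) (S : Finset V) {x : V} (hx : x ∈ S) :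
    EReal.exp ((loopMeasureAvoiding lam z {x} (S : Set V)ᶜ : ℝ≥0∞) : EReal) =
      evalAt z (closedGen lam (S : Set V) x) := by
  rw [loopMeasureAvoiding_finset hlam z S hx]
  exact exp_tsum_coeff_div (constantCoeff_excursionGen lam _ _) (closedGen_eq lam hx) z

/-- Monotone convergence along a directed index set: a finite partial sum involves finitely many
conditions, which hold together from some index on. No countability of `V` is needed. -/
theorem tendsto_tsum_ite {α ι : Type*} [SemilatticeSup ι] [Nonempty ι] (c : α → ℝ≥0∞)
    (P : α → Prop) (Q : ι → α → Prop) [DecidablePred P] [∀ i a, Decidable (Q i a)] (hQ : ∀ a, Monotone fun i => Q i a) (hP : ∀ a, P a ↔ ∃ i, Q i a) :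
    Tendsto (fun i => ∑' a, if Q i a then c a else 0) atTop
      (𝓝 (∑' a, if P a then c a else 0)) := by
  classical
  have hmono : Monotone fun i => ∑' a, if Q i a then c a else 0 := by
    intro i j hij
    refine ENNReal.tsum_le_tsum fun a => ?_
    by_cases h : Q i a
    · rw [if_pos h, if_pos (hQ a hij h)]
    · rw [if_neg h]; exact zero_le
  have hsup : ∑' a, (if P a then c a else 0) = ⨆ i, ∑' a, if Q i a then c a else 0 := by
    refine le_antisymm ?_ (iSup_le fun i => ENNReal.tsum_le_tsum fun a => ?_)
    · rw [ENNReal.tsum_eq_iSup_sum]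
      refine iSup_le fun t => ?_
      obtain ⟨i, hi⟩ : ∃ i, ∀ a ∈ t, P a → Q i a := by
        have h : ∀ a, ∃ i, P a → Q i a := fun a => by
          by_cases ha : P a
          · exact ((hP a).1 ha).imp fun i hi _ => hi
          · exact ⟨Classical.arbitrary ι, fun h => absurd h ha⟩
        choose f hf using h
        obtain ⟨i, hi⟩ := (t.image f).exists_le
        exact ⟨i, fun a ha hPa => hQ a (hi _ (Finset.mem_image_of_mem f ha)) (hf a hPa)⟩
      refine le_iSup_of_le i (le_trans (Finset.sum_le_sum fun a ha => ?_) (ENNReal.sum_le_tsum t))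
      by_cases h : P a
      · rw [if_pos h, if_pos (hi a ha h)]
      · rw [if_neg h]; exact zero_le
    · by_cases h : Q i a
      · rw [if_pos h, if_pos ((hP a).2 ⟨i, h⟩)]
      · rw [if_neg h]; exact zero_le
  rw [hsup]
  exact tendsto_atTop_iSup hmono

open scoped Classical in
theorem evalAt_walkGen (z : ℝ≥0) (P : G.Walk u v → Prop) :
    evalAt z (walkGen lam P) = ∑' p : G.Walk u v, if P p then (weight lam z p : ℝ≥0∞) else 0 := by
  rw [walkGen, evalAt_genFun]
  refine Eq.trans (tsum_congr fun p => ?_)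
    ((tsum_subtype {p | P p} fun p : G.Walk u v => (weight lam z p : ℝ≥0∞)).trans
      (tsum_congr fun p => ?_))
  · rw [weight_eq]
    push_cast
    rfl
  · rw [Set.indicator_apply]
    rfl

/-- A walk visits finitely many vertices, so a walk in `U` lies in some finite subset of `U`. Both
sides are limits along such subsets, and `EReal.exp` is continuous, also at `∞`. -/
theorem exp_loopMeasureAvoiding_singleton {lam : SAPolygon G → ℝ≥0}
    (hlam : RotationInvariant lam) (z : ℝ≥0) {U : Set V} {x : V} (hx : x ∈ U) :
    EReal.exp ((loopMeasureAvoiding lam z {x} Uᶜ : ℝ≥0∞) : EReal) =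
      evalAt z (closedGen lam U x) := by
  classical
  -- Inserting `x` makes the finite-set formula applicable for every `S`.
  let T : Finset V → Finset V := fun S => insert x (S.filter (· ∈ U))
  have hT : ∀ {a b : V} (p : G.Walk a b), Monotone fun S => Inside (T S : Set V) p := by
    intro a b p S S' hS h y hy
    exact Finset.insert_subset_insert x (Finset.filter_subset_filter _ hS) (h y hy)
  have hU : ∀ {a b : V} (p : G.Walk a b), Inside U p ↔ ∃ S, Inside (T S : Set V) p := by
    intro a b p
    constructor
    · intro h
      refine ⟨p.support.toFinset, fun y hy => ?_⟩
      exact Finset.mem_insert_of_mem (Finset.mem_filter.2 ⟨List.mem_toFinset.2 hy, h y hy⟩)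
    · rintro ⟨S, h⟩ y hy
      rcases Finset.mem_insert.1 (h y hy) with rfl | h'
      · exact hx
      · exact (Finset.mem_filter.1 h').2
  have hG : Tendsto (fun S => evalAt z (closedGen lam (T S : Set V) x)) atTop
      (𝓝 (evalAt z (closedGen lam U x))) := by
    simp only [closedGen, evalAt_walkGen]
    exact tendsto_tsum_ite _ _ _ hT hU
  have hM : Tendsto (fun S => loopMeasureAvoiding lam z {x} (T S : Set V)ᶜ) atTop
      (𝓝 (loopMeasureAvoiding lam z {x} Uᶜ)) := by
    simp only [loopMeasureAvoiding_compl]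
    refine tendsto_tsum_ite _ _
      (fun S (t : Σ y : V, G.Walk y y) => 1 ≤ t.2.length ∧ (range t.2 ∩ {x}).Nonempty ∧ Inside (T S : Set V) t.2) ?_ ?_
    · exact fun t S S' hS h => ⟨h.1, h.2.1, hT t.2 hS h.2.2⟩
    · intro t
      rw [hU]
      simp only [exists_and_left]
  have hE := (EReal.expHomeomorph.continuous.comp continuous_coe_ennreal_ereal).tendsto
    (loopMeasureAvoiding lam z {x} Uᶜ)
  refine tendsto_nhds_unique (hE.comp hM) (hG.congr fun S => ?_)
  exact (exp_loopMeasureAvoiding_finset hlam z (T S) (Finset.mem_insert_self _ _)).symm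

/-- A loop hitting the range either visits `u`, or avoids `u` and hits the range of `η`. -/
theorem loopMeasureAvoiding_range_cons {w : V} (z : ℝ≥0) (U : Set V) (h : G.Adj u v)
    (η : G.Walk v w) :
    loopMeasureAvoiding lam z (range (η.cons h)) Uᶜ =
      loopMeasureAvoiding lam z {u} Uᶜ + loopMeasureAvoiding lam z (range η) (U \ {u})ᶜ := by
  classical
  rw [loopMeasureAvoiding_compl, loopMeasureAvoiding_compl, loopMeasureAvoiding_compl,
    ← ENNReal.tsum_add]
  refine tsum_congr fun t => ?_
  have h1 : range (η.cons h) = {u} ∪ range η := by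
    ext y; simp [range]
  have h2 : (range t.2 ∩ {u}).Nonempty ↔ u ∈ t.2.support := by
    rw [Set.inter_singleton_nonempty]; rfl
  rw [h1, Set.inter_union_distrib_left, Set.union_nonempty, inside_diff, h2]
  by_cases h3 : u ∈ t.2.support <;> simp [h3]

theorem evalAt_erasedGen {lam : SAPolygon G → ℝ≥0} (hlam : RotationInvariant lam) (z : ℝ≥0)
    {U : Set V} (η : G.Walk u v) (hη : η.IsPath) (hU : Inside U η) :
    evalAt z (erasedGen lam U η) = (z : ℝ≥0∞) ^ η.length *
      EReal.exp ((loopMeasureAvoiding lam z (range η) Uᶜ : ℝ≥0∞) : EReal) := by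
  induction η generalizing U with
  | @nil u =>
    have h : range (Walk.nil : G.Walk u u) = {u} := by ext y; simp [range]
    rw [erasedGen_nil, h, exp_loopMeasureAvoiding_singleton hlam z (inside_nil.1 hU)]
    simp
  | @cons u v w h η ih =>
    obtain ⟨hu, hin⟩ := inside_cons.1 hU
    obtain ⟨hp, hu'⟩ := (Walk.cons_isPath_iff h η).1 hη
    have hX : evalAt z X = z := by
      rw [evalAt, tsum_eq_single 1]
      · simp
      · intro n hn
        simp [coeff_X, hn]
    rw [erasedGen_cons lam hu, evalAt_mul, evalAt_mul, hX, ih hp (inside_diff.2 ⟨hin, hu'⟩),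
      loopMeasureAvoiding_range_cons, EReal.coe_ennreal_add, EReal.exp_add,
      exp_loopMeasureAvoiding_singleton hlam z hu, Walk.length_cons]
    ring

theorem tsum_weight_eq {lam : SAPolygon G → ℝ≥0} (hlam : RotationInvariant lam) (z : ℝ≥0)
    (η : G.Walk u v) (hη : η.IsPath) :
    ∑' ω : {ω : G.Walk u v // loopErase ω = η}, (weight lam z ω.1 : ℝ≥0∞) =
      (z : ℝ≥0∞) ^ η.length * EReal.exp ((loopMeasure lam z (range η) : ℝ≥0∞) : EReal) := by
  have h := evalAt_erasedGen hlam z (U := Set.univ) η hη fun _ _ => Set.mem_univ _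
  rw [Set.compl_univ] at h
  rw [loopMeasure, ← h, erasedGen, walkGen, evalAt_genFun]
  have hP : (fun p : G.Walk u v => Inside Set.univ p ∧ loopErase p = η) =
      fun p => loopErase p = η := by
    ext p; simp [Inside]
  rw [hP]
  refine tsum_congr fun p => ?_
  rw [weight_eq]
  push_cast
  rfl

theorem tsum_weight_le_susceptibility (z : ℝ≥0) (η : G.Walk u v) :
    ∑' ω : {ω : G.Walk u v // loopErase ω = η}, (weight lam z ω.1 : ℝ≥0∞) ≤
      susceptibility lam z u :=
  (ENNReal.tsum_comp_le_tsum_of_injective Subtype.val_injective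
    fun ω : G.Walk u v => (weight lam z ω : ℝ≥0∞)).trans
    (ENNReal.le_tsum (f := fun y => ∑' ω : G.Walk u y, (weight lam z ω : ℝ≥0∞)) v)

theorem loopMeasure_zero (A : Set V) : loopMeasure lam 0 A = 0 := by
  classical
  refine ENNReal.tsum_eq_zero.2 fun x => ENNReal.tsum_eq_zero.2 fun ω => ?_
  split_ifs with h
  · rw [weight_eq, zero_pow (by omega)]
    simp
  · rfl

end LoopMeasure

end LWW

/-- Loop measure representation of loop-weighted walk on an arbitrary graph, as an identity in
`[0, ∞]` (with `exp ∞ = ∞`) at every activity `z ≥ 0`; all its terms are finite whenever the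
susceptibility at the initial vertex of `η` is. -/
theorem mainTheorem3 {V : Type*} [DecidableEq V] (G : SimpleGraph V)
    (lam : LWW.SAPolygon G → ℝ≥0) (hlam : LWW.RotationInvariant lam) (z : ℝ≥0)
    {u v : V} (η : G.Walk u v) (hη : η.IsPath) :
    LWW.loopErasedWeight lam z η =
        ∑' ω : {ω : G.Walk u v // LWW.loopErase ω = η}, (LWW.weight lam z ω.1 : ℝ≥0∞) ∧
      ∑' ω : {ω : G.Walk u v // LWW.loopErase ω = η}, (LWW.weight lam z ω.1 : ℝ≥0∞) =
        (z : ℝ≥0∞) ^ η.length *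
          EReal.exp ((LWW.loopMeasure lam z (LWW.range η) : ℝ≥0∞) : EReal) ∧
      (LWW.susceptibility lam z u ≠ ∞ →
        LWW.loopErasedWeight lam z η ≠ ∞ ∧ LWW.loopMeasure lam z (LWW.range η) ≠ ∞) := by
  have h1 : LWW.loopErasedWeight lam z η =
      ∑' ω : {ω : G.Walk u v // LWW.loopErase ω = η}, (LWW.weight lam z ω.1 : ℝ≥0∞) := by
    rw [LWW.loopErasedWeight, if_pos hη]
  have h2 := LWW.tsum_weight_eq hlam z η hη
  refine ⟨h1, h2, fun hs => ?_⟩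
  have h3 := ne_top_of_le_ne_top hs (LWW.tsum_weight_le_susceptibility lam z η)
  refine ⟨h1 ▸ h3, fun htop => ?_⟩
  -- At `z = 0` the right-hand side can be `0 * ∞ = 0`, so its finiteness says nothing about the
  -- measure, which is zero directly.
  rcases eq_or_ne z 0 with rfl | hz
  · rw [LWW.loopMeasure_zero] at htop
    exact ENNReal.zero_ne_top htop
  · rw [h2, htop, EReal.coe_ennreal_top, EReal.exp_top, ENNReal.mul_top] at h3
    · exact h3 rfl
    · exact pow_ne_zero _ (ENNReal.coe_ne_zero.2 hz)
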